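/- Let $n\ge 0$ and $m\ge 1$ be integers. A crossingless matching on $n$ strands is a partition of $n$ bottom points and $n$ top points on the boundary of a horizontal strip into pairs which can be joined by pairwise disjoint strands inside the strip. A strand joining two bottom points is a cap, a strand joining two top points is a cup, and a strand joining a bottom point to a top point is a through strand. The bottom half of a matching consists of its caps and the bottom ends of its through strands, and the top half consists of its cups and the top ends of its through strands. Let $m\mathcal{TL}_n$ be the $m$-cyclic Temperley--Lieb monoid. Its elements are the pairs $(a,i)$ with $a$ a crossingless matching on $n$ strands and $i\in\mathbb{Z}/m\mathbb{Z}$ (the number of internal circles modulo $m$), and its multiplication is $(a,i)(b,j)=(ab,\,i+j+\Phi(a,b))$, where $ab$ is obtained by gluing $a$ on top of $b$ and removing the closed components, and $\Phi(a,b)$ is the number of closed components removed. Write $\mathcal{TL}_n=1\mathcal{TL}_n$ for the Temperley--Lieb monoid. In a monoid put $a\le_l b$ if $b=ca$ for some $c$, $a\le_r b$ if $b=ac$ for some $c$, and $a\le_{lr}b$ if $b=cad$ for some $c,d$. Write $a\sim b$ if $a\le b$ and $b\le a$, and $a<b$ if $a\le b$ and $b\not\le a$, for each of these orders. The left, right and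 $J$-cells are the equivalence classes of $\sim_l$, $\sim_r$ and $\sim_{lr}$. The $H$-cells are the nonempty intersections of a left cell with a right cell. A cell is idempotent if it contains an idempotent, and a monoid is regular if all its $J$-cells are idempotent. For $0\le k\le n$ with $k\equiv n \pmod 2$ let $c(k)=(n-k)/2$, and let $\mathcal{J}_k\subseteq m\mathcal{TL}_n$ be the set of elements with exactly $k$ through strands. Then the following hold. 0. $m\mathcal{TL}_n$ has the cell structure of $\mathcal{TL}_n$ with each $H$-cell inflated to size $m$: for each of the orders $\le_l,\le_r,\le_{lr}$ one has $(a,i)\le(b,j)$ in $m\mathcal{TL}_n$ if and only if $a\le b$ in $\mathcal{TL}_n$, and the $H$-cells of $m\mathcal{TL}_n$ are exactly the sets $\{(a,i)\mid i\in\mathbb{Z}/m\mathbb{Z}\}$, which have $m$ elements. 1. Two elements lie in the same left cell if and only if they have the same bottom half, and in the same right cell if and only if they have the same top half. 2. The $J$-cells are exactly the sets $\mathcal{J}_k$ with $0\le k\le n$ and $k\equiv n\pmod 2$. 3. The orders increase as the number of through strands decreases: if $x\le_l y$ or $x\le_r y$, then $y$ has at most as many through strands as $x$, and strictly fewer if $x<_l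 y$ or $x<_r y$ respectively. Moreover, $x\le_{lr}y$ if and only if $y$ has at most as many through strands as $x$. In particular, $\le_{lr}$ induces a total order on the set of $J$-cells. 4. Every left cell $\mathcal{L}\subseteq\mathcal{J}_k$ and every right cell $\mathcal{R}\subseteq\mathcal{J}_k$ satisfies $$|\mathcal{L}|=|\mathcal{R}|=m\left(\frac{k+1}{n-c(k)+1}\right)\binom{n}{c(k)}.$$ 5. For every left cell $\mathcal{L}\subseteq\mathcal{J}_k$ one has $|\mathcal{J}_k|=|\mathcal{L}|^2/m$. 6. Every $J$-cell is idempotent, i.e. $m\mathcal{TL}_n$ is regular. 7. Every idempotent $H$-cell is, under the multiplication of $m\mathcal{TL}_n$, a cyclic group of order $m$. -/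

import Mathlib

namespace TemperleyLieb

/-- The `2n` boundary points of a diagram: `Sum.inl i` is the `i`-th bottom point and
`Sum.inr i` is the `i`-th top point, both counted from the left. -/
abbrev Pt (n : ℕ) : Type := Fin n ⊕ Fin n

/-- Position of a boundary point when the boundary of the strip is traversed along the bottom
from left to right and then along the top from right to left. -/
def pos {n : ℕ} : Pt n → ℕ :=
  Sum.elim (fun i => (i : ℕ)) (fun i => n + (i.rev : ℕ))

/-- The conditions on an equivalence relation on the boundary points to be the relation "is an
endpoint of the same strand" of a crossingless matching: every point is joined to exactly one
other point, and no two strands cross. -/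
structure IsCrossinglessMatching {n : ℕ} (r : Setoid (Pt n)) : Prop where
  existsUnique_mate : ∀ p, ∃! q, q ≠ p ∧ r p q
  noncrossing : ∀ p q p' q', pos p < pos q → pos q < pos p' → pos p' < pos q' →
    r p p' → r q q' → False

/-- Crossingless matchings without internal components from `n` points to `n` points, up to
equivalence, given as partitions of the `2n` boundary points into pairs. -/
@[ext]
structure Diagram (n : ℕ) where
  rel : Setoid (Pt n)
  isCrossingless : IsCrossinglessMatching rel

/-- The points of two diagrams glued on top of each other: three rows of `n` points each,
row `0` at the bottom, row `1` in the middle and row `2` at the top. -/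
abbrev GluePt (n : ℕ) : Type := Fin 3 × Fin n

/-- The boundary points of the lower diagram among the glued points. -/
def lower {n : ℕ} : Pt n → GluePt n := Sum.elim (fun i => (0, i)) (fun i => (1, i))

/-- The boundary points of the upper diagram among the glued points. -/
def upper {n : ℕ} : Pt n → GluePt n := Sum.elim (fun i => (1, i)) (fun i => (2, i))

/-- The boundary points of the composite diagram among the glued points. -/
def outer {n : ℕ} : Pt n → GluePt n := Sum.elim (fun i => (0, i)) (fun i => (2, i))

/-- The relation "lies in the same connected component" on the points of the diagram obtained by
gluing `a` on top of `b`: the equivalence relation generated by the strands of `b` (between the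
rows `0` and `1`) and the strands of `a` (between the rows `1` and `2`). -/
def glue {n : ℕ} (a b : Setoid (Pt n)) : Setoid (GluePt n) :=
  b.map lower ⊔ a.map upper

/-- The number of connected components that contain none of the points `o p`. -/
noncomputable def internalCount {V P : Type} (g : Setoid V) (o : P → V) : ℕ :=
  Nat.card {c : Quotient g // ∀ p, c ≠ Quotient.mk g (o p)}

/-- The number of internal components created by gluing `a` on top of `b`. -/
noncomputable def Phi {n : ℕ} (a b : Diagram n) : ℕ :=
  internalCount (glue a.rel b.rel) outer

theorem le_iff {V : Type} {r s : Setoid V} : r ≤ s ↔ ∀ x y, r x y → s x y := Iff.rfl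

theorem map_le {V W : Type} {r : Setoid V} {f : V → W} {s : Setoid W} :
    r.map f ≤ s ↔ r ≤ s.comap f := by
  constructor
  · intro h x y hxy
    exact h (Relation.EqvGen.rel _ _ ⟨x, y, hxy, rfl, rfl⟩)
  · intro h
    apply Setoid.eqvGen_le
    rintro _ _ ⟨x, y, hxy, rfl, rfl⟩
    exact h hxy

theorem map_mk {V W : Type} {r : Setoid V} (f : V → W) {x y : V} (h : r x y) :
    r.map f (f x) (f y) :=
  Relation.EqvGen.rel _ _ ⟨x, y, h, rfl, rfl⟩

theorem map_iff {V W : Type} {r : Setoid V} {f : V → W} (hf : Function.Injective f) {u v : W} :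
    r.map f u v ↔ u = v ∨ ∃ x y, u = f x ∧ v = f y ∧ r x y := by
  have h := Setoid.coe_map_of_ker_le r f (by
    intro x y hxy
    have hh : f x = f y := hxy
    rw [hf hh])
  rw [h]
  constructor
  · rintro (⟨x, y, hxy, rfl, rfl⟩ | h)
    · exact Or.inr ⟨x, y, rfl, rfl, hxy⟩
    · exact Or.inl h
  · rintro (h | ⟨x, y, rfl, rfl, hxy⟩)
    · exact Or.inr h
    · exact Or.inl ⟨x, y, hxy, rfl, rfl⟩

theorem map_map {V W X : Type} (r : Setoid V) (f : V → W) (g : W → X) :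
    (r.map f).map g = r.map (g ∘ f) :=
  le_antisymm
    (map_le.2 (map_le.2 fun _ _ h => map_mk (g ∘ f) h))
    (map_le.2 fun _ _ h => map_mk g (map_mk f h))

theorem map_sup {V W : Type} (r s : Setoid V) (f : V → W) :
    (r ⊔ s).map f = r.map f ⊔ s.map f := by
  apply le_antisymm
  · exact map_le.2 (sup_le (map_le.1 le_sup_left) (map_le.1 le_sup_right))
  · exact sup_le (map_le.2 fun _ _ h => map_mk f (le_sup_left (a := r) h))
      (map_le.2 fun _ _ h => map_mk f (le_sup_right (a := r) h))

/-- Gluing in two steps: connected components of the full picture seen on a part. -/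
theorem comap_two_step {P V W : Type} (G : Setoid V) (o : P → V) (r : Setoid P)
    (i j : V → W) (hi : Function.Injective i) (hj : Function.Injective j) (s t : P → V)
    (hos : ∀ p, i (o p) = j (s p))
    (hmeet : ∀ u x, i u = j x → ∃ p, u = o p ∧ x = s p) :
    (G.map i ⊔ r.map (j ∘ t)).comap j = (G.comap o).map s ⊔ r.map t := by
  apply le_antisymm
  · -- a candidate relation on `W`
    intro x y hxy
    let E := (G.comap o).map s ⊔ r.map t
    have hsG : ∀ p q, G (o p) (o q) → E (s p) (s q) := fun p q h =>
      le_sup_left (a := (G.comap o).map s) (map_mk s (r := G.comap o) h)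
    -- relation on W: generated by E on range j, extended along G
    let R : Setoid W :=
      { r := fun u v =>
          (∃ x y, (G.map i) u (j x) ∧ (G.map i) v (j y) ∧ E x y) ∨ (G.map i) u v
        iseqv := by
          have key : ∀ x y, (G.map i) (j x) (j y) → E x y := by
            intro x y h
            rcases (map_iff hi).1 h with h | ⟨a, b, ha, hb, hab⟩
            · rw [hj h]
            · obtain ⟨p, rfl, rfl⟩ := hmeet a x ha.symm
              obtain ⟨q, rfl, rfl⟩ := hmeet b y hb.symm
              exact hsG p q hab
          refine ⟨fun u => Or.inr ((G.map i).refl u), ?_, ?_⟩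
          · rintro u v (⟨x, y, hu, hv, h⟩ | h)
            · exact Or.inl ⟨y, x, hv, hu, E.symm h⟩
            · exact Or.inr ((G.map i).symm h)
          · rintro u v w (⟨x, y, hu, hv, h⟩ | h) (⟨x', y', hu', hv', h'⟩ | h')
            · exact Or.inl ⟨x, y', hu, hv',
                E.trans h (E.trans (key _ _ ((G.map i).trans ((G.map i).symm hv) hu')) h')⟩
            · exact Or.inl ⟨x, y, hu, (G.map i).trans ((G.map i).symm h') hv, h⟩
            · exact Or.inl ⟨x', y', (G.map i).trans h hu', hv', h'⟩
            · exact Or.inr ((G.map i).trans h h') }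
    have hR : G.map i ⊔ r.map (j ∘ t) ≤ R := by
      refine sup_le (fun u v h => Or.inr h) (map_le.2 fun p q h => Or.inl ?_)
      exact ⟨t p, t q, (G.map i).refl _, (G.map i).refl _,
        le_sup_right (a := (G.comap o).map s) (map_mk t h)⟩
    have key : ∀ x y, (G.map i) (j x) (j y) → E x y := by
      intro x y h
      rcases (map_iff hi).1 h with h | ⟨a, b, ha, hb, hab⟩
      · rw [hj h]
      · obtain ⟨p, rfl, rfl⟩ := hmeet a x ha.symm
        obtain ⟨q, rfl, rfl⟩ := hmeet b y hb.symm
        exact hsG p q hab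
    rcases hR hxy with ⟨x', y', hx, hy, h⟩ | h
    · exact E.trans (key _ _ hx) (E.trans h (E.symm (key _ _ hy)))
    · exact key _ _ h
  · refine sup_le (map_le.2 fun p q h => ?_) (map_le.2 fun p q h => ?_)
    · change (G.map i ⊔ r.map (j ∘ t)) (j (s p)) (j (s q))
      rw [← hos, ← hos]
      exact le_sup_left (a := G.map i) (map_mk i h)
    · exact le_sup_right (a := G.map i) (map_mk (j ∘ t) h)

theorem internalCount_two_step {P V W : Type} [Finite V] [Finite W]
    (G : Setoid V) (o : P → V) (r : Setoid P)
    (i j : V → W) (hi : Function.Injective i) (s t o' : P → V)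
    (hos : ∀ p, i (o p) = j (s p))
    (hmeet : ∀ u x, i u = j x → ∃ p, u = o p ∧ x = s p)
    (hcov : ∀ w, (∃ u, i u = w) ∨ (∃ x, j x = w)) :
    internalCount (G.map i ⊔ r.map (j ∘ t)) (j ∘ o') =
      internalCount G o + internalCount ((G.map i ⊔ r.map (j ∘ t)).comap j) o' := by
  set T := G.map i ⊔ r.map (j ∘ t) with hT
  have hGT : ∀ {u v}, G u v → T (i u) (i v) := fun h =>
    le_sup_left (a := G.map i) (map_mk i h)
  have F1 : ∀ u, (∀ p, ¬ G u (o p)) → ∀ w, T (i u) w → ∃ u', w = i u' ∧ G u u' := by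
    intro u hu w hw
    have hle : T ≤ Setoid.ker (fun w => ∃ u', w = i u' ∧ G u u') := by
      refine sup_le (map_le.2 fun a b h => ?_) (map_le.2 fun p q _ => ?_)
      · apply propext
        constructor
        · rintro ⟨u', h1, h2⟩
          exact ⟨b, rfl, G.trans (hi h1 ▸ h2) h⟩
        · rintro ⟨u', h1, h2⟩
          exact ⟨a, rfl, G.trans (hi h1 ▸ h2) (G.symm h)⟩
      · have no : ∀ p, ¬ ∃ u', (j ∘ t) p = i u' ∧ G u u' := by
          rintro p ⟨u', h1, h2⟩
          obtain ⟨p', rfl, _⟩ := hmeet u' (t p) h1.symm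
          exact hu p' h2
        exact propext (iff_of_false (no p) (no q))
    have hh : (∃ u', i u = i u' ∧ G u u') = (∃ u', w = i u' ∧ G u u') := hle hw
    rw [← hh]
    exact ⟨u, rfl, G.refl u⟩
  have F2 : ∀ u, (∀ p, ¬ G u (o p)) → ∀ x, ¬ T (i u) (j x) := by
    intro u hu x h
    obtain ⟨u', h1, h2⟩ := F1 u hu _ h
    obtain ⟨p, rfl, _⟩ := hmeet u' x h1.symm
    exact hu p h2
  let f1 : Quotient G → Quotient T := Quotient.map i fun _ _ h => hGT h
  let f2 : Quotient (T.comap j) → Quotient T := Quotient.map j fun _ _ h => h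
  let f : {c : Quotient G // ∀ p, c ≠ Quotient.mk G (o p)} ⊕
      {c : Quotient (T.comap j) // ∀ p, c ≠ Quotient.mk (T.comap j) (o' p)} →
      {c : Quotient T // ∀ p, c ≠ Quotient.mk T ((j ∘ o') p)} :=
    Sum.elim
      (fun c => ⟨f1 c.1, by
        obtain ⟨c, hc⟩ := c
        induction c using Quotient.inductionOn with
        | h u =>
          intro p h
          exact F2 u (fun p h => hc p (Quotient.sound h)) _ (Quotient.exact h)⟩)
      (fun c => ⟨f2 c.1, by
        obtain ⟨c, hc⟩ := c
        induction c using Quotient.inductionOn with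
        | h x =>
          intro p h
          have h' : T (j x) (j (o' p)) := Quotient.exact h
          exact hc p (Quotient.sound h')⟩)
  have hf : Function.Bijective f := by
    constructor
    · rintro (⟨c, hc⟩ | ⟨c, hc⟩) (⟨d, hd⟩ | ⟨d, hd⟩) h
      all_goals
        obtain ⟨u, rfl⟩ := Quotient.exists_rep c
        obtain ⟨v, rfl⟩ := Quotient.exists_rep d
        have h' := Subtype.ext_iff.1 h
      · have h'' : T (i u) (i v) := Quotient.exact h'
        obtain ⟨u', h1, h2⟩ := F1 u (fun p h => hc p (Quotient.sound h)) _ h''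
        have : G u v := by rw [hi h1]; exact h2
        congr 2
        exact Quotient.sound this
      · have h'' : T (i u) (j v) := Quotient.exact h'
        exact (F2 u (fun p h => hc p (Quotient.sound h)) _ h'').elim
      · have h'' : T (j u) (i v) := Quotient.exact h'
        exact (F2 v (fun p h => hd p (Quotient.sound h)) _ (T.symm h'')).elim
      · have h'' : T (j u) (j v) := Quotient.exact h'
        congr 2
        exact Quotient.sound h''
    · rintro ⟨c, hc⟩
      induction c using Quotient.inductionOn with
      | h w =>
      have onj : ∀ x, T w (j x) → ∃ a, f a = ⟨Quotient.mk T w, hc⟩ := by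
        intro x hx
        refine ⟨Sum.inr ⟨Quotient.mk _ x, fun p h => ?_⟩, ?_⟩
        · have h' : T (j x) (j (o' p)) := Quotient.exact (s := T.comap j) h
          exact hc p (Quotient.sound (T.trans hx h'))
        · apply Subtype.ext
          exact Quotient.sound (T.symm hx)
      rcases hcov w with ⟨u, rfl⟩ | ⟨x, rfl⟩
      · by_cases hu : ∀ p, ¬ G u (o p)
        · exact ⟨Sum.inl ⟨Quotient.mk _ u, fun p h => hu p (Quotient.exact h)⟩, rfl⟩
        · push Not at hu
          obtain ⟨p, hp⟩ := hu
          apply onj (s p)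
          rw [← hos]
          exact hGT hp
      · exact onj x (T.refl _)
  unfold internalCount
  rw [← Nat.card_congr (Equiv.ofBijective f hf), Nat.card_sum]

theorem existsUnique_other_end {V : Type} [Finite V] (α β : Equiv.Perm V)
    (hα : ∀ v, α (α v) = v) (hβ : ∀ v, β (β v) = v) (hdis : ∀ v, α v = v → β v ≠ v)
    (E : Setoid V) (hEα : ∀ v, E v (α v)) (hEβ : ∀ v, E v (β v))
    (hmin : ∀ T : Set V, (∀ v ∈ T, α v ∈ T) → (∀ v ∈ T, β v ∈ T) →
      ∀ p q, E p q → p ∈ T → q ∈ T)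
    (p : V) (hp : β p = p) :
    ∃! q, q ≠ p ∧ (α q = q ∨ β q = q) ∧ E p q := by
  let ρ : Equiv.Perm V := α * β
  have hβρ : ∀ k : ℤ, β ((ρ ^ k) p) = (ρ ^ (-k)) p := by
    have h1 : β * ρ * β⁻¹ = ρ⁻¹ := by
      ext v
      have : β⁻¹ = β := by ext v; rw [Equiv.Perm.inv_eq_iff_eq, hβ]
      have h2 : α⁻¹ = α := by ext v; rw [Equiv.Perm.inv_eq_iff_eq, hα]
      simp [ρ, this, h2, hβ]
    intro k
    have h2 : β * ρ ^ k * β⁻¹ = ρ ^ (-k) := by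
      rw [← conj_zpow, h1, inv_zpow, zpow_neg]
    rw [← h2]
    have h3 : β⁻¹ p = p := by rw [Equiv.Perm.inv_eq_iff_eq, hp]
    rw [Equiv.Perm.mul_apply, Equiv.Perm.mul_apply, h3]
  have hαρ : ∀ k : ℤ, α ((ρ ^ k) p) = (ρ ^ (1 - k)) p := by
    intro k
    have : α ((ρ ^ k) p) = ρ (β ((ρ ^ k) p)) := by simp [ρ, hβ]
    rw [this, hβρ, sub_eq_add_neg, zpow_add, zpow_one]; rfl
  have hEρ : ∀ k : ℤ, E p ((ρ ^ k) p) := by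
    have step : ∀ v, E v (ρ v) := fun v => E.trans (hEβ v) (hEα _)
    intro k
    induction k using Int.induction_on with
    | zero => exact E.refl _
    | succ k ih =>
      rw [add_comm, zpow_add, zpow_one]
      exact E.trans ih (step _)
    | pred k ih =>
      refine E.trans ih (E.symm ?_)
      have := step ((ρ ^ (-(k : ℤ) - 1)) p)
      rwa [← Equiv.Perm.mul_apply, ← zpow_one_add, show (1 : ℤ) + (-(k : ℤ) - 1) = -k by ring]
        at this
  have horb : ∀ q, E p q → ∃ k : ℤ, q = (ρ ^ k) p := by
    intro q hq
    refine hmin {v | ∃ k : ℤ, v = (ρ ^ k) p} ?_ ?_ p q hq ⟨0, rfl⟩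
    · rintro _ ⟨k, rfl⟩; exact ⟨_, hαρ k⟩
    · rintro _ ⟨k, rfl⟩; exact ⟨_, hβρ k⟩
  let N : ℤ := Function.minimalPeriod (ρ • ·) p
  have hN : ∀ k : ℤ, (ρ ^ k) p = p ↔ N ∣ k := fun k =>
    MulAction.zpow_smul_eq_iff_minimalPeriod_dvd (a := ρ) (b := p)
  have hN2 : ∀ k l : ℤ, (ρ ^ k) p = (ρ ^ l) p ↔ N ∣ k - l := by
    intro k l
    rw [← hN, sub_eq_neg_add, zpow_add, zpow_neg, Equiv.Perm.mul_apply,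
      Equiv.Perm.inv_eq_iff_eq]
  have hNpos : 0 < N := by
    have : 0 < Function.minimalPeriod (ρ • ·) p := by
      apply Function.minimalPeriod_pos_of_mem_periodicPts
      obtain ⟨k, hk, h⟩ := (isOfFinOrder_of_finite ρ).exists_pow_eq_one
      refine ⟨k, hk, ?_⟩
      have h2 : (ρ ^ k) p = p := by rw [h]; rfl
      rw [Function.IsPeriodicPt, Function.IsFixedPt, smul_iterate]
      exact h2
    exact Int.natCast_pos.2 this
  have hfix : ∀ k : ℤ, (α ((ρ ^ k) p) = (ρ ^ k) p ∨ β ((ρ ^ k) p) = (ρ ^ k) p) ↔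
      (N ∣ 1 - 2 * k ∨ N ∣ 2 * k) := by
    intro k
    rw [hαρ, hβρ, hN2, hN2, show 1 - k - k = 1 - 2 * k by ring,
      show - k - k = -(2 * k) by ring, dvd_neg]
  have hN1 : N ≠ 1 := by
    intro h
    have h1 : (ρ ^ (1 : ℤ)) p = p := by rw [hN, h]
    have : α p = p := by
      have h2 : ρ p = p := by simpa using h1
      simpa [ρ, hp] using h2
    exact hdis p this hp
  obtain ⟨M, hM | hM⟩ := Int.even_or_odd' N
  · refine ⟨(ρ ^ M) p, ⟨?_, ?_, hEρ _⟩, ?_⟩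
    · rw [Ne, hN]; intro h
      have := Int.le_of_dvd (by omega) h
      omega
    · rw [hfix]; right; rw [hM]
    · rintro q ⟨h1, h2, h3⟩
      obtain ⟨k, rfl⟩ := horb q h3
      rw [Ne, hN] at h1
      rw [hfix] at h2
      rw [hN2]
      rcases h2 with ⟨c, hc⟩ | ⟨c, hc⟩
      · exfalso
        rw [hM, mul_assoc] at hc
        omega
      · have hk : k = M * c := by
          rw [hM, mul_assoc] at hc; omega
        obtain ⟨d, hd | hd⟩ := Int.even_or_odd' c
        · exfalso; apply h1; exact ⟨d, by rw [hk, hM, hd]; ring⟩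
        · exact ⟨d, by rw [hk, hM, hd]; ring⟩
  · refine ⟨(ρ ^ (M + 1)) p, ⟨?_, ?_, hEρ _⟩, ?_⟩
    · rw [Ne, hN]; intro h
      have := Int.le_of_dvd (by omega) h
      omega
    · rw [hfix]; left; exact ⟨-1, by rw [hM]; ring⟩
    · rintro q ⟨h1, h2, h3⟩
      obtain ⟨k, rfl⟩ := horb q h3
      rw [Ne, hN] at h1
      rw [hfix] at h2
      have hcop : IsCoprime N 2 := ⟨1, -M, by rw [hM]; ring⟩
      rw [hN2]
      rcases h2 with h | h
      · refine hcop.dvd_of_dvd_mul_left ?_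
        have : 2 * (k - (M + 1)) = -(1 - 2 * k) - N := by rw [hM]; ring
        rw [this]
        exact dvd_sub (dvd_neg.2 h) dvd_rfl
      · exact (h1 (hcop.dvd_of_dvd_mul_left h)).elim

theorem lower_injective {n : ℕ} : Function.Injective (lower (n := n)) := by
  rintro (p | p) (q | q) h <;> simp_all [lower]

theorem upper_injective {n : ℕ} : Function.Injective (upper (n := n)) := by
  rintro (p | p) (q | q) h <;> simp_all [upper]

theorem outer_injective {n : ℕ} : Function.Injective (outer (n := n)) := by
  rintro (p | p) (q | q) h <;> simp_all [outer]

theorem pos_injective {n : ℕ} : Function.Injective (pos (n := n)) := by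
  rintro (p | p) (q | q) h <;> simp [pos, Fin.ext_iff] at h ⊢ <;> omega

theorem exists_mate {n : ℕ} {r : Setoid (Pt n)} (h : ∀ p, ∃! q, q ≠ p ∧ r p q) :
    ∃ f : Pt n → Pt n, (∀ p, f (f p) = p) ∧ (∀ p, f p ≠ p) ∧ (∀ p, r p (f p)) ∧
      (∀ p q, r p q → q = p ∨ q = f p) := by
  choose f hf hf' using h
  refine ⟨f, fun p => ?_, fun p => (hf p).1, fun p => (hf p).2, fun p q hq => ?_⟩
  · exact (hf' (f p) p ⟨(hf p).1.symm, r.symm (hf p).2⟩).symm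
  · by_cases hqp : q = p
    · exact Or.inl hqp
    · exact Or.inr (hf' p q ⟨hqp, hq⟩)

theorem comp_existsUnique {n : ℕ} {a b : Setoid (Pt n)}
    (ha : ∀ p, ∃! q, q ≠ p ∧ a p q) (hb : ∀ p, ∃! q, q ≠ p ∧ b p q) (p : Pt n) :
    ∃! q, q ≠ p ∧ (glue a b).comap outer p q := by
  obtain ⟨f, f1, f2, f3, f4⟩ := exists_mate ha
  obtain ⟨g, g1, g2, g3, g4⟩ := exists_mate hb
  let up : GluePt n → Pt n := fun v => if v.1 = 1 then Sum.inl v.2 else Sum.inr v.2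
  let lo : GluePt n → Pt n := fun v => if v.1 = 0 then Sum.inl v.2 else Sum.inr v.2
  have hup : ∀ p, up (upper p) = p := by rintro (p | p) <;> simp [up, upper]
  have hlo : ∀ p, lo (lower p) = p := by rintro (p | p) <;> simp [lo, lower]
  have hup0 : ∀ p, (upper p : GluePt n).1 ≠ 0 := by rintro (p | p) <;> simp [upper]
  have hlo2 : ∀ p, (lower p : GluePt n).1 ≠ 2 := by rintro (p | p) <;> simp [lower]
  have hup' : ∀ v, v.1 ≠ 0 → upper (up v) = v := by
    rintro ⟨r, x⟩ h; fin_cases r <;> simp [up, upper] at h ⊢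
  have hlo' : ∀ v, v.1 ≠ 2 → lower (lo v) = v := by
    rintro ⟨r, x⟩ h; fin_cases r <;> simp [lo, lower] at h ⊢
  let α0 : GluePt n → GluePt n := fun v => if v.1 = 0 then v else upper (f (up v))
  let β0 : GluePt n → GluePt n := fun v => if v.1 = 2 then v else lower (g (lo v))
  have hα0 : Function.Involutive α0 := by
    intro v
    by_cases h : v.1 = 0
    · simp [α0, h]
    · simp [α0, h, hup0, hup, f1, hup' v h]
  have hβ0 : Function.Involutive β0 := by
    intro v
    by_cases h : v.1 = 2
    · simp [β0, h]
    · simp [β0, h, hlo2, hlo, g1, hlo' v h]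
  have fixα : ∀ v, α0 v = v ↔ v.1 = 0 := by
    intro v
    by_cases h : v.1 = 0
    · simp [α0, h]
    · simp only [α0, h, if_false, iff_false]
      intro h'
      apply f2 (up v)
      rw [← hup (f (up v)), h']
  have fixβ : ∀ v, β0 v = v ↔ v.1 = 2 := by
    intro v
    by_cases h : v.1 = 2
    · simp [β0, h]
    · simp only [β0, h, if_false, iff_false]
      intro h'
      apply g2 (lo v)
      rw [← hlo (g (lo v)), h']
  have hEα : ∀ v, glue a b v (α0 v) := by
    intro v
    by_cases h : v.1 = 0
    · simp only [α0, h, if_true]; exact (glue a b).refl v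
    · have h2 := le_sup_right (a := b.map lower) (map_mk upper (f3 (up v)))
      simp only [α0, h, if_false]
      rw [hup' v h] at h2
      exact h2
  have hEβ : ∀ v, glue a b v (β0 v) := by
    intro v
    by_cases h : v.1 = 2
    · simp only [β0, h, if_true]; exact (glue a b).refl v
    · have h2 := le_sup_left (b := a.map upper) (map_mk lower (g3 (lo v)))
      simp only [β0, h, if_false]
      rw [hlo' v h] at h2
      exact h2
  have hmin : ∀ T : Set (GluePt n), (∀ v ∈ T, α0 v ∈ T) → (∀ v ∈ T, β0 v ∈ T) →
      ∀ p q, glue a b p q → p ∈ T → q ∈ T := by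
    intro T hTα hTβ p q hpq hp
    have hle : glue a b ≤ Setoid.ker (· ∈ T) := by
      refine sup_le (map_le.2 fun x y h => ?_) (map_le.2 fun x y h => ?_)
      · apply propext
        rcases g4 x y h with rfl | rfl
        · rfl
        · have e1 : β0 (lower x) = lower (g x) := by simp [β0, hlo2, hlo]
          have e2 : β0 (lower (g x)) = lower x := by simp [β0, hlo2, hlo, g1]
          exact ⟨fun h => e1 ▸ hTβ _ h, fun h => e2 ▸ hTβ _ h⟩
      · apply propext
        rcases f4 x y h with rfl | rfl
        · rfl
        · have e1 : α0 (upper x) = upper (f x) := by simp [α0, hup0, hup]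
          have e2 : α0 (upper (f x)) = upper x := by simp [α0, hup0, hup, f1]
          exact ⟨fun h => e1 ▸ hTα _ h, fun h => e2 ▸ hTα _ h⟩
    have hh : (p ∈ T) = (q ∈ T) := hle hpq
    rw [← hh]; exact hp
  have main : ∃! q : GluePt n, q ≠ outer p ∧ (q.1 = 0 ∨ q.1 = 2) ∧ glue a b (outer p) q := by
    have hcase : (outer p : GluePt n).1 = 0 ∨ (outer p : GluePt n).1 = 2 := by
      rcases p with p | p <;> simp [outer]
    rcases hcase with h0 | h2
    · have := existsUnique_other_end hβ0.toPerm hα0.toPerm hβ0 hα0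
        (fun v h h' => by
          have h1 := (fixα v).1 h'
          have h2 := (fixβ v).1 h
          rw [h1] at h2; exact absurd h2 (by decide))
        (glue a b) hEβ hEα (fun T h h' => hmin T h' h) (outer p) ((fixα _).2 h0)
      simpa only [Function.Involutive.coe_toPerm, fixα, fixβ, or_comm] using this
    · have := existsUnique_other_end hα0.toPerm hβ0.toPerm hα0 hβ0
        (fun v h h' => by
          have h1 := (fixα v).1 h
          have h2 := (fixβ v).1 h'
          rw [h1] at h2; exact absurd h2 (by decide))
        (glue a b) hEα hEβ hmin (outer p) ((fixβ _).2 h2)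
      simpa only [Function.Involutive.coe_toPerm, fixα, fixβ] using this
  obtain ⟨q, ⟨h1, h2, h3⟩, hq⟩ := main
  have : ∃ q', outer q' = q := by
    obtain ⟨r, x⟩ := q
    rcases h2 with h2 | h2
    · exact ⟨Sum.inl x, Prod.ext h2.symm rfl⟩
    · exact ⟨Sum.inr x, Prod.ext h2.symm rfl⟩
  obtain ⟨q', rfl⟩ := this
  refine ⟨q', ⟨fun h => h1 (by rw [h]), h3⟩, ?_⟩
  rintro y ⟨y1, y2⟩
  apply outer_injective
  refine hq _ ⟨fun h => y1 (outer_injective h), ?_, y2⟩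
  rcases y with y | y <;> simp [outer]

open Classical in
theorem sum_saturated {n : ℕ} {r : Setoid (Pt n)} (h : ∀ p, ∃! q, q ≠ p ∧ r p q)
    (S : Pt n → Prop) (hS : ∀ p q, q ≠ p → r p q → S p → S q) :
    ∑ s, (if S s then (1 : ZMod 2) else 0) = 0 := by
  obtain ⟨f, f1, f2, f3, -⟩ := exists_mate h
  have hSf : ∀ s, S (f s) ↔ S s := fun s =>
    ⟨fun hs => by
      have := hS (f s) (f (f s)) (f2 _) (f3 _) hs
      rwa [f1] at this, fun hs => hS s (f s) (f2 s) (f3 s) hs⟩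
  refine Finset.sum_involution (fun s _ => f s) ?_ ?_ ?_ ?_
  · intro s _
    simp only [hSf]
    split_ifs <;> decide
  · intro s _ _; exact f2 s
  · intro s _; exact Finset.mem_univ _
  · intro s _; exact f1 s

open Classical in
/-- The parity of the number of points of `S` in the row of `p` to the left of `p`. -/
noncomputable def leftParity {n : ℕ} (S : Pt n → Prop) : Pt n → ZMod 2 :=
  Sum.elim (fun i => ∑ x : Fin n, if S (Sum.inl x) ∧ x < i then 1 else 0)
    (fun i => ∑ x : Fin n, if S (Sum.inr x) ∧ x < i then 1 else 0)

open Classical in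
theorem leftParity_eq {n : ℕ} (S : Pt n → Prop)
    (heven : ∑ s, (if S s then (1 : ZMod 2) else 0) = 0) (p : Pt n) (hp : ¬ S p) :
    leftParity S p = ∑ s, if S s ∧ pos s < pos p then 1 else 0 := by
  rw [Fintype.sum_sum_type]
  rcases p with i | i
  · have : ∀ x : Fin n, ¬ (pos (Sum.inr x) < pos (Sum.inl i)) := by
      intro x; simp [pos]; omega
    simp only [this, and_false, if_false, Finset.sum_const_zero, add_zero]
    rfl
  · have h1 : ∀ x : Fin n, pos (Sum.inl x) < pos (Sum.inr i) := by
      intro x; simp [pos]; omega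
    have h2 : ∀ x : Fin n, pos (Sum.inr x) < pos (Sum.inr i) ↔ i < x := by
      intro x; simp only [pos, Sum.elim_inr, Fin.val_rev, Fin.lt_def]; omega
    rw [Fintype.sum_sum_type] at heven
    simp only [h1, h2, and_true]
    have h3 : ∑ x : Fin n, (if S (Sum.inr x) then (1 : ZMod 2) else 0) =
        (∑ x : Fin n, if S (Sum.inr x) ∧ x < i then (1 : ZMod 2) else 0) +
        ∑ x : Fin n, if S (Sum.inr x) ∧ i < x then (1 : ZMod 2) else 0 := by
      rw [← Finset.sum_add_distrib]
      refine Finset.sum_congr rfl fun x _ => ?_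
      rcases lt_trichotomy x i with h | h | h
      · simp [h, h.not_gt]
      · subst h; simp [hp]
      · simp [h, h.not_gt]
    rw [h3] at heven
    simp only [leftParity, Sum.elim_inr]
    have hneg : ∀ x y z : ZMod 2, x + (y + z) = 0 → y = x + z := by decide
    exact hneg _ _ _ heven

open Classical in
theorem leftParity_const {n : ℕ} {r : Setoid (Pt n)} (hr : IsCrossinglessMatching r)
    (S : Pt n → Prop) (hS : ∀ p q, r p q → S p → S q) (p q : Pt n) (hpq : r p q) (hp : ¬ S p) :
    leftParity S p = leftParity S q := by
  wlog hlt : pos p < pos q generalizing p q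
  · by_cases h : p = q
    · rw [h]
    · refine (this q p (r.symm hpq) (fun h => hp (hS _ _ (r.symm hpq) h)) ?_).symm
      exact lt_of_le_of_ne (not_lt.1 hlt) fun h' => h (pos_injective h'.symm)
  have hq : ¬ S q := fun h => hp (hS _ _ (r.symm hpq) h)
  have heven := sum_saturated hr.existsUnique_mate S (fun p q _ h => hS p q h)
  rw [leftParity_eq S heven p hp, leftParity_eq S heven q hq]
  have hmid := sum_saturated hr.existsUnique_mate
    (fun s => S s ∧ pos p < pos s ∧ pos s < pos q) (by
      rintro s t hts hst ⟨h1, h2, h3⟩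
      have ht : S t := hS _ _ hst h1
      have htp : pos t ≠ pos p := fun h => hp (pos_injective h ▸ ht)
      have htq : pos t ≠ pos q := fun h => hq (pos_injective h ▸ ht)
      refine ⟨ht, ?_, ?_⟩
      · by_contra h
        exact hr.noncrossing t p s q (by omega) h2 h3 (r.symm hst) hpq
      · by_contra h
        exact hr.noncrossing p s q t h2 h3 (by omega) hpq hst)
  rw [← add_zero (∑ s, if S s ∧ pos s < pos p then (1 : ZMod 2) else 0)]
  refine (congrArg _ hmid.symm).trans ?_
  rw [← Finset.sum_add_distrib]
  refine Finset.sum_congr rfl fun s _ => ?_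
  by_cases hs : S s
  · have hsp : pos s ≠ pos p := fun h => hp (pos_injective h ▸ hs)
    by_cases h1 : pos s < pos p
    · have h2 : pos s < pos q := by omega
      simp [hs, h1, h2, h1.not_gt]
    · have h2 : pos p < pos s := by omega
      simp [hs, h1, h2]
  · simp [hs]

open Classical in
theorem comp_noncrossing {n : ℕ} {a b : Setoid (Pt n)} (ha : IsCrossinglessMatching a)
    (hb : IsCrossinglessMatching b) (p q p' q' : Pt n) (h1 : pos p < pos q)
    (h2 : pos q < pos p') (h3 : pos p' < pos q') (hp : (glue a b).comap outer p p')
    (hq : (glue a b).comap outer q q') : False := by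
  have huniq := comp_existsUnique ha.existsUnique_mate hb.existsUnique_mate
  obtain ⟨f, f1, f2, f3, f4⟩ := exists_mate huniq
  have hpne : p' ≠ p := by rintro rfl; omega
  have hqne : q' ≠ q := by rintro rfl; omega
  have hnot : ∀ s, pos s ≠ pos q → pos s ≠ pos q' → ¬ glue a b (outer q) (outer s) := by
    intro s hs1 hs2 hs
    have e1 : q' = f q := (f4 q q' hq).resolve_left hqne
    rcases f4 q s hs with h | h
    · exact hs1 (by rw [h])
    · exact hs2 (by rw [h, e1])
  let C : GluePt n → Prop := fun v => glue a b (outer q) v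
  have hC : ∀ u v, glue a b u v → C u → C v := fun u v h h' => (glue a b).trans h' h
  let F : GluePt n → ZMod 2 := fun v => ∑ x : Fin n, if C (v.1, x) ∧ x < v.2 then 1 else 0
  have Flo : ∀ x, F (lower x) = leftParity (fun s => C (lower s)) x := by
    rintro (x | x) <;> rfl
  have Fup : ∀ x, F (upper x) = leftParity (fun s => C (upper s)) x := by
    rintro (x | x) <;> rfl
  have Fou : ∀ x, F (outer x) = leftParity (fun s => C (outer s)) x := by
    rintro (x | x) <;> rfl
  have hlo : ∀ x y, b x y → glue a b (lower x) (lower y) := fun x y h =>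
    le_sup_left (b := a.map upper) (map_mk lower h)
  have hup : ∀ x y, a x y → glue a b (upper x) (upper y) := fun x y h =>
    le_sup_right (a := b.map lower) (map_mk upper h)
  have hle : glue a b ≤ Setoid.ker (fun v => if C v then none else some (F v)) := by
    refine sup_le (map_le.2 fun x y h => ?_) (map_le.2 fun x y h => ?_)
    · change (if C (lower x) then none else some (F (lower x))) =
        if C (lower y) then none else some (F (lower y))
      by_cases hx : C (lower x)
      · rw [if_pos hx, if_pos (hC _ _ (hlo x y h) hx)]
      · rw [if_neg hx, if_neg fun hy => hx (hC _ _ (hlo y x (b.symm h)) hy), Flo, Flo]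
        congr 1
        exact leftParity_const hb _ (fun s t hst => hC _ _ (hlo s t hst)) x y h hx
    · change (if C (upper x) then none else some (F (upper x))) =
        if C (upper y) then none else some (F (upper y))
      by_cases hx : C (upper x)
      · rw [if_pos hx, if_pos (hC _ _ (hup x y h) hx)]
      · rw [if_neg hx, if_neg fun hy => hx (hC _ _ (hup y x (a.symm h)) hy), Fup, Fup]
        congr 1
        exact leftParity_const ha _ (fun s t hst => hC _ _ (hup s t hst)) x y h hx
  have hpC : ¬ C (outer p) := hnot p (by omega) (by omega)
  have hpC' : ¬ C (outer p') := hnot p' (by omega) (by omega)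
  have hF : F (outer p) = F (outer p') := by
    have := hle hp
    change (if C (outer p) then none else some (F (outer p))) =
      if C (outer p') then none else some (F (outer p')) at this
    rw [if_neg hpC, if_neg hpC'] at this
    exact Option.some.inj this
  have heven := sum_saturated huniq (fun s => C (outer s)) (fun s t _ hst => hC _ _ hst)
  rw [Fou, Fou, leftParity_eq _ heven p hpC, leftParity_eq _ heven p' hpC'] at hF
  have hCs : ∀ s, C (outer s) → pos s = pos q ∨ pos s = pos q' := by
    intro s hs
    by_contra h
    push Not at h
    exact hnot s h.1 h.2 hs
  rw [Finset.sum_eq_zero, Finset.sum_eq_single q] at hF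
  · rw [if_pos ⟨(glue a b).refl _, h2⟩] at hF
    exact absurd hF (by decide)
  · intro s _ hsq
    rw [if_neg]
    rintro ⟨hs, hlt⟩
    rcases hCs s hs with h | h
    · exact hsq (pos_injective h)
    · omega
  · intro h; exact absurd (Finset.mem_univ _) h
  · intro s _
    rw [if_neg]
    rintro ⟨hs, hlt⟩
    rcases hCs s hs with h | h <;> omega

namespace Diagram

/-- The composite of `a` on top of `b`, with the internal components removed: two boundary points
are joined if they lie in the same component of the glued diagram. -/
def comp {n : ℕ} (a b : Diagram n) : Diagram n where
  rel := (glue a.rel b.rel).comap outer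
  isCrossingless :=
    ⟨comp_existsUnique a.isCrossingless.existsUnique_mate b.isCrossingless.existsUnique_mate,
      comp_noncrossing a.isCrossingless b.isCrossingless⟩

/-- The identity diagram: the `i`-th bottom point is joined to the `i`-th top point. -/
def id (n : ℕ) : Diagram n where
  rel := Setoid.ker (Sum.elim (fun i => i) (fun i => i))
  isCrossingless := by
    refine ⟨?_, ?_⟩
    · rintro (p | p)
      · refine ⟨Sum.inr p, ⟨by simp, rfl⟩, ?_⟩
        rintro (q | q) ⟨h1, h2⟩ <;> have h3 : p = q := h2 <;> simp_all
      · refine ⟨Sum.inl p, ⟨by simp, rfl⟩, ?_⟩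
        rintro (q | q) ⟨h1, h2⟩ <;> have h3 : p = q := h2 <;> simp_all
    · rintro (p | p) (q | q) (p' | p') (q' | q') h1 h2 h3 hp hq <;>
        replace hp : p = p' := hp <;> replace hq : q = q' := hq <;> subst hp hq <;>
        simp [pos] at h1 h2 h3 <;> omega

end Diagram

theorem glue_id_left {n : ℕ} (b : Diagram n) :
    glue (Diagram.id n).rel b.rel =
      b.rel.comap (fun v => if v.1 = 0 then Sum.inl v.2 else Sum.inr v.2) := by
  have hlo : ∀ p q, b.rel p q → glue (Diagram.id n).rel b.rel (lower p) (lower q) := fun p q h =>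
    le_sup_left (b := (Diagram.id n).rel.map upper) (map_mk lower h)
  have hup : ∀ x, glue (Diagram.id n).rel b.rel (1, x) (2, x) := fun x =>
    le_sup_right (a := b.rel.map lower)
      (map_mk upper (x := Sum.inl x) (y := Sum.inr x) (r := (Diagram.id n).rel) rfl)
  apply le_antisymm
  · refine sup_le (map_le.2 ?_) (map_le.2 ?_)
    · rintro (x | x) (y | y) h <;> exact h
    · rintro (x | x) (y | y) h <;> obtain rfl : x = y := h <;> exact b.rel.refl _
  · have key : ∀ v : GluePt n, glue (Diagram.id n).rel b.rel v
        (lower (if v.1 = 0 then Sum.inl v.2 else Sum.inr v.2)) := by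
      rintro ⟨r, x⟩
      fin_cases r
      · exact (glue (Diagram.id n).rel b.rel).refl _
      · exact (glue (Diagram.id n).rel b.rel).refl _
      · exact (glue (Diagram.id n).rel b.rel).symm (hup x)
    intro u v h
    exact (glue _ _).trans (key u) ((glue _ _).trans (hlo _ _ h) ((glue _ _).symm (key v)))

theorem glue_id_right {n : ℕ} (a : Diagram n) :
    glue a.rel (Diagram.id n).rel =
      a.rel.comap (fun v => if v.1 = 2 then Sum.inr v.2 else Sum.inl v.2) := by
  have hup : ∀ p q, a.rel p q → glue a.rel (Diagram.id n).rel (upper p) (upper q) := fun p q h =>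
    le_sup_right (a := (Diagram.id n).rel.map lower) (map_mk upper h)
  have hlo : ∀ x, glue a.rel (Diagram.id n).rel (0, x) (1, x) := fun x =>
    le_sup_left (b := a.rel.map upper)
      (map_mk lower (x := Sum.inl x) (y := Sum.inr x) (r := (Diagram.id n).rel) rfl)
  apply le_antisymm
  · refine sup_le (map_le.2 ?_) (map_le.2 ?_)
    · rintro (x | x) (y | y) h <;> obtain rfl : x = y := h <;> exact a.rel.refl _
    · rintro (x | x) (y | y) h <;> exact h
  · have key : ∀ v : GluePt n, glue a.rel (Diagram.id n).rel v
        (upper (if v.1 = 2 then Sum.inr v.2 else Sum.inl v.2)) := by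
      rintro ⟨r, x⟩
      fin_cases r
      · exact hlo x
      · exact (glue a.rel (Diagram.id n).rel).refl _
      · exact (glue a.rel (Diagram.id n).rel).refl _
    intro u v h
    exact (glue _ _).trans (key u) ((glue _ _).trans (hup _ _ h) ((glue _ _).symm (key v)))

theorem internalCount_eq_zero {V P : Type} (g : Setoid V) (o : P → V)
    (h : ∀ v, ∃ p, g v (o p)) : internalCount g o = 0 := by
  have : IsEmpty {c : Quotient g // ∀ p, c ≠ Quotient.mk g (o p)} := by
    refine ⟨fun ⟨c, hc⟩ => ?_⟩
    obtain ⟨v, rfl⟩ := Quotient.exists_rep c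
    obtain ⟨p, hp⟩ := h v
    exact hc p (Quotient.sound hp)
  exact Nat.card_of_isEmpty

theorem Phi_id_left {n : ℕ} (b : Diagram n) : Phi (Diagram.id n) b = 0 := by
  apply internalCount_eq_zero
  rw [glue_id_left]
  rintro ⟨r, x⟩
  fin_cases r
  · exact ⟨Sum.inl x, b.rel.refl _⟩
  · exact ⟨Sum.inr x, b.rel.refl _⟩
  · exact ⟨Sum.inr x, b.rel.refl _⟩

theorem Phi_id_right {n : ℕ} (a : Diagram n) : Phi a (Diagram.id n) = 0 := by
  apply internalCount_eq_zero
  rw [glue_id_right]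
  rintro ⟨r, x⟩
  fin_cases r
  · exact ⟨Sum.inl x, a.rel.refl _⟩
  · exact ⟨Sum.inl x, a.rel.refl _⟩
  · exact ⟨Sum.inr x, a.rel.refl _⟩

theorem id_comp {n : ℕ} (b : Diagram n) : (Diagram.id n).comp b = b := by
  apply Diagram.ext
  change (glue (Diagram.id n).rel b.rel).comap outer = b.rel
  rw [glue_id_left]
  ext p q
  rcases p with p | p <;> rcases q with q | q <;> exact Iff.rfl

theorem comp_id {n : ℕ} (a : Diagram n) : a.comp (Diagram.id n) = a := by
  apply Diagram.ext
  change (glue a.rel (Diagram.id n).rel).comap outer = a.rel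
  rw [glue_id_right]
  ext p q
  rcases p with p | p <;> rcases q with q | q <;> exact Iff.rfl

/-- Both ways of gluing three diagrams are computed by gluing them simultaneously. -/
theorem glue_three {n : ℕ} (a b c : Diagram n) :
    (a.comp b).comp c = a.comp (b.comp c) ∧
      Phi a b + Phi (a.comp b) c = Phi b c + Phi a (b.comp c) := by
  let i1 : GluePt n → Fin 4 × Fin n := fun v => (v.1.succ, v.2)
  let i2 : GluePt n → Fin 4 × Fin n := fun v => (v.1.castSucc, v.2)
  let j1 : GluePt n → Fin 4 × Fin n := fun v => (![0, 1, 3] v.1, v.2)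
  let j2 : GluePt n → Fin 4 × Fin n := fun v => (![0, 2, 3] v.1, v.2)
  have hi1 : Function.Injective i1 := by
    rintro ⟨r, x⟩ ⟨s, y⟩ h
    have h' := Prod.ext_iff.1 h
    exact Prod.ext (Fin.succ_injective _ h'.1) h'.2
  have hi2 : Function.Injective i2 := by
    rintro ⟨r, x⟩ ⟨s, y⟩ h
    have h' := Prod.ext_iff.1 h
    exact Prod.ext (Fin.castSucc_injective _ h'.1) h'.2
  have hj1 : Function.Injective j1 := by
    rintro ⟨r, x⟩ ⟨s, y⟩ h
    have h' := Prod.ext_iff.1 h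
    exact Prod.ext ((by decide : Function.Injective (![0, 1, 3] : Fin 3 → Fin 4)) h'.1) h'.2
  have hj2 : Function.Injective j2 := by
    rintro ⟨r, x⟩ ⟨s, y⟩ h
    have h' := Prod.ext_iff.1 h
    exact Prod.ext ((by decide : Function.Injective (![0, 2, 3] : Fin 3 → Fin 4)) h'.1) h'.2
  have fe : ∀ {f g : Pt n → Fin 4 × Fin n}, (∀ x, f (Sum.inl x) = g (Sum.inl x)) →
      (∀ x, f (Sum.inr x) = g (Sum.inr x)) → f = g := by
    intro f g h1 h2
    funext p
    rcases p with p | p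
    · exact h1 p
    · exact h2 p
  have e1 : i1 ∘ outer = j1 ∘ upper := fe (fun _ => rfl) (fun _ => rfl)
  have e2 : i2 ∘ outer = j2 ∘ lower := fe (fun _ => rfl) (fun _ => rfl)
  have e3 : j1 ∘ lower = i2 ∘ lower := fe (fun _ => rfl) (fun _ => rfl)
  have e4 : j2 ∘ upper = i1 ∘ upper := fe (fun _ => rfl) (fun _ => rfl)
  have e5 : i1 ∘ lower = i2 ∘ upper := fe (fun _ => rfl) (fun _ => rfl)
  have e6 : j1 ∘ outer = j2 ∘ outer := fe (fun _ => rfl) (fun _ => rfl)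
  have m1 : ∀ u x, i1 u = j1 x → ∃ p, u = outer p ∧ x = upper p := by
    rintro ⟨r, x⟩ ⟨s, y⟩ h
    have h' := Prod.ext_iff.1 h
    obtain rfl : x = y := h'.2
    have h1 : r.succ = ![0, 1, 3] s := h'.1
    have h2 : ∀ r s : Fin 3, r.succ = (![0, 1, 3] : Fin 3 → Fin 4) s →
        (r = 0 ∧ s = 1) ∨ (r = 2 ∧ s = 2) := by decide
    rcases h2 r s h1 with ⟨rfl, rfl⟩ | ⟨rfl, rfl⟩
    · exact ⟨Sum.inl x, rfl, rfl⟩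
    · exact ⟨Sum.inr x, rfl, rfl⟩
  have m2 : ∀ u x, i2 u = j2 x → ∃ p, u = outer p ∧ x = lower p := by
    rintro ⟨r, x⟩ ⟨s, y⟩ h
    have h' := Prod.ext_iff.1 h
    obtain rfl : x = y := h'.2
    have h1 : r.castSucc = ![0, 2, 3] s := h'.1
    have h2 : ∀ r s : Fin 3, r.castSucc = (![0, 2, 3] : Fin 3 → Fin 4) s →
        (r = 0 ∧ s = 0) ∨ (r = 2 ∧ s = 1) := by decide
    rcases h2 r s h1 with ⟨rfl, rfl⟩ | ⟨rfl, rfl⟩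
    · exact ⟨Sum.inl x, rfl, rfl⟩
    · exact ⟨Sum.inr x, rfl, rfl⟩
  have c1 : ∀ w, (∃ u, i1 u = w) ∨ (∃ x, j1 x = w) := by
    rintro ⟨r, x⟩
    have : ∀ r : Fin 4, (∃ s : Fin 3, s.succ = r) ∨
        (∃ s, (![0, 1, 3] : Fin 3 → Fin 4) s = r) := by decide
    rcases this r with ⟨s, hs⟩ | ⟨s, hs⟩
    · exact Or.inl ⟨(s, x), Prod.ext hs rfl⟩
    · exact Or.inr ⟨(s, x), Prod.ext hs rfl⟩
  have c2 : ∀ w, (∃ u, i2 u = w) ∨ (∃ x, j2 x = w) := by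
    rintro ⟨r, x⟩
    have : ∀ r : Fin 4, (∃ s : Fin 3, s.castSucc = r) ∨
        (∃ s, (![0, 2, 3] : Fin 3 → Fin 4) s = r) := by decide
    rcases this r with ⟨s, hs⟩ | ⟨s, hs⟩
    · exact Or.inl ⟨(s, x), Prod.ext hs rfl⟩
    · exact Or.inr ⟨(s, x), Prod.ext hs rfl⟩
  -- the simultaneous gluing
  have T1 : (glue a.rel b.rel).map i1 ⊔ c.rel.map (j1 ∘ lower) =
      (glue b.rel c.rel).map i2 ⊔ a.rel.map (j2 ∘ upper) := by
    rw [glue, glue, map_sup, map_sup, map_map, map_map, map_map, map_map, e3, e4, e5]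
    rw [sup_assoc, sup_comm (a.rel.map _), ← sup_assoc, sup_comm (b.rel.map _)]
  have A1 := comap_two_step (glue a.rel b.rel) outer c.rel i1 j1 hi1 hj1 upper lower
    (fun p => congrFun e1 p) m1
  have A2 := comap_two_step (glue b.rel c.rel) outer a.rel i2 j2 hi2 hj2 lower upper
    (fun p => congrFun e2 p) m2
  have B1 := internalCount_two_step (glue a.rel b.rel) outer c.rel i1 j1 hi1 upper lower outer
    (fun p => congrFun e1 p) m1 c1
  have B2 := internalCount_two_step (glue b.rel c.rel) outer a.rel i2 j2 hi2 lower upper outer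
    (fun p => congrFun e2 p) m2 c2
  have G1 : glue (a.comp b).rel c.rel =
      ((glue a.rel b.rel).map i1 ⊔ c.rel.map (j1 ∘ lower)).comap j1 := by
    rw [A1, sup_comm]; rfl
  have G2 : glue a.rel (b.comp c).rel =
      ((glue b.rel c.rel).map i2 ⊔ a.rel.map (j2 ∘ upper)).comap j2 := by
    rw [A2]; rfl
  rw [← G1] at B1
  rw [← G2] at B2
  constructor
  · apply Diagram.ext
    change (glue (a.comp b).rel c.rel).comap outer = (glue a.rel (b.comp c).rel).comap outer
    rw [G1, G2, T1]
    have hcc : ∀ (j : GluePt n → Fin 4 × Fin n) (T : Setoid (Fin 4 × Fin n)),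
        (T.comap j).comap outer = T.comap (j ∘ outer (n := n)) := fun j T => by
      ext p q; exact Iff.rfl
    rw [hcc, hcc, e6]
  · change internalCount _ _ + internalCount _ _ = internalCount _ _ + internalCount _ _
    rw [← B1, ← B2, T1, e6]

/-- The `m`-cyclic Temperley--Lieb monoid on `n` strands: crossingless matchings with `n` bottom
and `n` top points, with the number of internal components counted modulo `m`. The case `m = 1`
is the Temperley--Lieb monoid. -/
@[ext]
structure CyclicTL (m n : ℕ) where
  /-- the strands -/
  skeleton : Diagram n
  /-- the number of internal components modulo `m` -/
  internal : ZMod m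

/-- `x * y` is the vertical concatenation with `x` on top of `y`. -/
noncomputable instance (m n : ℕ) : Monoid (CyclicTL m n) where
  mul x y := ⟨x.skeleton.comp y.skeleton,
    x.internal + y.internal + (Phi x.skeleton y.skeleton : ZMod m)⟩
  one := ⟨Diagram.id n, 0⟩
  mul_assoc x y z := by
    obtain ⟨h1, h2⟩ := glue_three x.skeleton y.skeleton z.skeleton
    have h3 := congrArg (Nat.cast (R := ZMod m)) h2
    push_cast at h3
    refine CyclicTL.ext h1 ?_
    change x.internal + y.internal + (Phi x.skeleton y.skeleton : ZMod m) + z.internal +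
        (Phi (x.skeleton.comp y.skeleton) z.skeleton : ZMod m) =
      x.internal + (y.internal + z.internal + (Phi y.skeleton z.skeleton : ZMod m)) +
        (Phi x.skeleton (y.skeleton.comp z.skeleton) : ZMod m)
    linear_combination h3
  one_mul x := by
    refine CyclicTL.ext (id_comp x.skeleton) ?_
    change 0 + x.internal + (Phi (Diagram.id n) x.skeleton : ZMod m) = x.internal
    rw [Phi_id_left]; simp
  mul_one x := by
    refine CyclicTL.ext (comp_id x.skeleton) ?_
    change x.internal + 0 + (Phi x.skeleton (Diagram.id n) : ZMod m) = x.internal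
    rw [Phi_id_right]; simp

/-- The bottom half of a diagram, i.e. its caps together with the bottom ends of its through
strands: the two ends of a cap are related to each other, and the bottom end of a through strand
is related only to itself. (Since strands do not cross, the upper ends of the through strands in
the bottom half are ordered from left to right like the lower ones.) -/
def Diagram.bottomHalf {n : ℕ} (d : Diagram n) : Setoid (Fin n) := d.rel.comap Sum.inl

/-- The top half of a diagram, i.e. its cups together with the top ends of its through strands. -/
def Diagram.topHalf {n : ℕ} (d : Diagram n) : Setoid (Fin n) := d.rel.comap Sum.inr

/-- The number of through strands, i.e. of strands joining a bottom point and a top point. -/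
noncomputable def Diagram.through {n : ℕ} (d : Diagram n) : ℕ :=
  {i : Fin n | ∃ j : Fin n, d.rel (Sum.inl i) (Sum.inr j)}.ncard

section Green

variable {S : Type} [Monoid S]

/-- The left cell order; left multiples are larger. -/
def LeftLE (a b : S) : Prop := ∃ c, b = c * a

/-- The right cell order. -/
def RightLE (a b : S) : Prop := ∃ c, b = a * c

/-- The two-sided cell order. -/
def TwoSidedLE (a b : S) : Prop := ∃ c d, b = c * a * d

/-- Left equivalence. -/
def LeftEquiv (a b : S) : Prop := LeftLE a b ∧ LeftLE b a

/-- Right equivalence. -/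
def RightEquiv (a b : S) : Prop := RightLE a b ∧ RightLE b a

/-- Two-sided equivalence. -/
def TwoSidedEquiv (a b : S) : Prop := TwoSidedLE a b ∧ TwoSidedLE b a

/-- Left cells are the classes of left equivalence. -/
def IsLeftCell (L : Set S) : Prop := ∃ a, L = {b | LeftEquiv a b}

/-- Right cells are the classes of right equivalence. -/
def IsRightCell (R : Set S) : Prop := ∃ a, R = {b | RightEquiv a b}

/-- `J`-cells are the classes of two-sided equivalence. -/
def IsJCell (J : Set S) : Prop := ∃ a, J = {b | TwoSidedEquiv a b}

/-- `H`-cells are the nonempty intersections of a left cell and a right cell. -/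
def IsHCell (H : Set S) : Prop :=
  H.Nonempty ∧ ∃ L R, IsLeftCell L ∧ IsRightCell R ∧ H = L ∩ R

/-- A cell is idempotent if it contains an idempotent. -/
def IsIdempotentCell (C : Set S) : Prop := ∃ e ∈ C, e * e = e

/-- The order on `J`-cells induced by the two-sided cell order. -/
def JCellLE (J K : {J : Set S // IsJCell J}) : Prop := ∀ a ∈ J.1, ∀ b ∈ K.1, TwoSidedLE a b

end Green

/-- The set of elements with exactly `k` through strands. -/
def throughClass (m n k : ℕ) : Set (CyclicTL m n) := {x | x.skeleton.through = k}

/-- The number `(n - k) / 2`, used for `k ≤ n` of the same parity as `n`. -/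
def capNumber (n k : ℕ) : ℕ := (n - k) / 2

/-- The underlying element of the Temperley--Lieb monoid, where internal components are removed. -/
def CyclicTL.toTL {m n : ℕ} (x : CyclicTL m n) : CyclicTL 1 n := ⟨x.skeleton, 0⟩

end TemperleyLieb

/-!
Reflection in a horizontal line is an anti-automorphism `a ↦ a*` of the diagrams, and `b (a* a) = b`
as soon as the caps of `a` are caps of `b`. Hence `a ≤ₗ b` exactly when the bottom half of `a` is
contained in that of `b`, and dually for `≤ᵣ`; the number of circles never matters, as the second
component of a left factor can be chosen freely.

A diagram is the same thing as a pair of halves with equally many unmatched points, because the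
through strands have to join these points in order. Arcs can be added to a half until any smaller
number of unmatched points of the right parity is left, which makes `≤ₗᵣ` the reversed order of the
numbers of through strands. Deleting the last point of a half gives the ballot recursion
`h (n + 1) (k + 1) = h n k + h n (k + 2)` for the number of halves with `k` unmatched points, which
is solved by the quotient in the theorem.
-/

namespace TemperleyLieb

variable {m n : ℕ}

theorem pos_swap (p : Pt n) : pos p.swap + pos p + 1 = 2 * n := by
  rcases p with i | i <;> simp only [pos, Sum.swap_inl, Sum.swap_inr, Sum.elim_inl, Sum.elim_inr,
    Fin.val_rev] <;> omega

theorem pos_inr_add (j : Fin n) : pos (Sum.inr j) + j + 1 = 2 * n := pos_swap (Sum.inl j)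

theorem pos_inr_mk_add {x : ℕ} (hx : x < n) : pos (Sum.inr (⟨x, hx⟩ : Fin n)) + x + 1 = 2 * n :=
  pos_inr_add ⟨x, hx⟩

theorem glue_lower {a b : Setoid (Pt n)} {p q : Pt n} (h : b p q) :
    glue a b (lower p) (lower q) :=
  le_sup_left (b := a.map upper) (map_mk lower h)

theorem glue_upper {a b : Setoid (Pt n)} {p q : Pt n} (h : a p q) :
    glue a b (upper p) (upper q) :=
  le_sup_right (a := b.map lower) (map_mk upper h)

namespace Diagram

/-- The other end of the strand of a diagram at a boundary point. -/
noncomputable def mate (d : Diagram n) (p : Pt n) : Pt n :=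
  (d.isCrossingless.existsUnique_mate p).choose

theorem mate_ne (d : Diagram n) (p : Pt n) : d.mate p ≠ p :=
  (d.isCrossingless.existsUnique_mate p).choose_spec.1.1

theorem rel_mate (d : Diagram n) (p : Pt n) : d.rel p (d.mate p) :=
  (d.isCrossingless.existsUnique_mate p).choose_spec.1.2

theorem eq_mate {d : Diagram n} {p q : Pt n} (hne : q ≠ p) (h : d.rel p q) : q = d.mate p :=
  (d.isCrossingless.existsUnique_mate p).choose_spec.2 q ⟨hne, h⟩

theorem rel_iff {d : Diagram n} {p q : Pt n} : d.rel p q ↔ q = p ∨ q = d.mate p := by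
  refine ⟨fun h => or_iff_not_imp_left.2 fun hne => eq_mate hne h, ?_⟩
  rintro (rfl | rfl)
  · exact d.rel.refl q
  · exact d.rel_mate p

theorem mate_mate (d : Diagram n) (p : Pt n) : d.mate (d.mate p) = p :=
  (eq_mate (d.mate_ne p).symm (d.rel.symm (d.rel_mate p))).symm

theorem eq_of_le {a b : Diagram n} (h : a.rel ≤ b.rel) : a = b := by
  have mate_eq (p : Pt n) : a.mate p = b.mate p := eq_mate (a.mate_ne p) (h (a.rel_mate p))
  ext p q
  rw [rel_iff, rel_iff, mate_eq]

theorem nested {d : Diagram n} {p q : Pt n} (hpq : pos p < pos q) (hq : pos q < pos (d.mate p)) :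
    pos p < pos (d.mate q) ∧ pos (d.mate q) < pos (d.mate p) := by
  have hp : pos (d.mate q) ≠ pos p := fun h => by
    rw [← pos_injective h, mate_mate] at hq
    exact hq.false
  have hp' : pos (d.mate q) ≠ pos (d.mate p) := fun h => by
    rw [← d.mate_mate q, pos_injective h, mate_mate] at hpq
    exact hpq.false
  refine ⟨hp.lt_or_gt.resolve_left fun h => ?_, hp'.lt_or_gt.resolve_right fun h => ?_⟩
  · exact d.isCrossingless.noncrossing _ p q _ h hpq hq (d.rel.symm (d.rel_mate q)) (d.rel_mate p)
  · exact d.isCrossingless.noncrossing p q _ _ hpq hq h (d.rel_mate p) (d.rel_mate q)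

theorem bottomHalf_le_comp (a b : Diagram n) : b.bottomHalf ≤ (a.comp b).bottomHalf :=
  fun i j h => glue_lower (p := .inl i) (q := .inl j) h

theorem topHalf_le_comp (a b : Diagram n) : a.topHalf ≤ (a.comp b).topHalf :=
  fun i j h => glue_upper (p := .inr i) (q := .inr j) h

/-- The reflection of a diagram in a horizontal line. -/
def flip (d : Diagram n) : Diagram n where
  rel := d.rel.comap Sum.swap
  isCrossingless :=
    { existsUnique_mate := fun p => by
        refine (Equiv.sumComm _ _).existsUnique_congr (fun {q} => ?_) |>.2
          (d.isCrossingless.existsUnique_mate p.swap)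
        exact and_congr_left fun _ => (Equiv.sumComm _ _).injective.ne_iff.symm
      noncrossing := fun p q p' q' hpq hqp' hpq' hp hq => by
        have := pos_swap p
        have := pos_swap q
        have := pos_swap p'
        have := pos_swap q'
        exact d.isCrossingless.noncrossing q'.swap p'.swap q.swap p.swap (by omega) (by omega)
          (by omega) (d.rel.symm hq) (d.rel.symm hp) }

theorem flip_flip (d : Diagram n) : d.flip.flip = d := by
  ext p q
  change d.rel p.swap.swap q.swap.swap ↔ d.rel p q
  rw [Sum.swap_swap, Sum.swap_swap]

theorem flip_injective : Function.Injective (flip (n := n)) :=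
  Function.LeftInverse.injective flip_flip

theorem flip_mate (d : Diagram n) (p : Pt n) : d.flip.mate p = (d.mate p.swap).swap :=
  (eq_mate (fun h => d.mate_ne p.swap (by rw [← Sum.swap_swap (d.mate _), h])) (by
    change d.rel p.swap (d.mate p.swap).swap.swap
    rw [Sum.swap_swap]
    exact d.rel_mate _)).symm

theorem flip_comp (a b : Diagram n) : (a.comp b).flip = b.flip.comp a.flip := by
  let turn (v : GluePt n) : GluePt n := (v.1.rev, v.2)
  have turn_lower (p : Pt n) : turn (lower p) = upper p.swap := by rcases p with i | i <;> rfl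
  have turn_upper (p : Pt n) : turn (upper p) = lower p.swap := by rcases p with i | i <;> rfl
  have turn_outer (p : Pt n) : turn (outer p.swap) = outer p := by rcases p with i | i <;> rfl
  have swap_rel {d : Diagram n} {p q : Pt n} (h : d.rel p q) : d.flip.rel p.swap q.swap := by
    change d.rel p.swap.swap q.swap.swap
    rwa [Sum.swap_swap, Sum.swap_swap]
  have glue_le : glue a.rel b.rel ≤ (glue b.flip.rel a.flip.rel).comap turn := by
    refine sup_le (map_le.2 fun p q h => ?_) (map_le.2 fun p q h => ?_)
    · change (glue _ _) (turn (lower p)) (turn (lower q))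
      rw [turn_lower, turn_lower]
      exact glue_upper (swap_rel h)
    · change (glue _ _) (turn (upper p)) (turn (upper q))
      rw [turn_upper, turn_upper]
      exact glue_lower (swap_rel h)
  refine eq_of_le fun p q h => ?_
  have := glue_le h
  change (glue _ _) (turn (outer p.swap)) (turn (outer q.swap)) at this
  rwa [turn_outer, turn_outer] at this

theorem flip_comp_self_rel {a : Diagram n} {i j : Fin n} (h : a.rel (.inl i) (.inr j)) :
    (a.flip.comp a).rel (.inl i) (.inr i) :=
  (glue a.flip.rel a.rel).trans (glue_lower h)
    (glue_upper (p := .inl j) (q := .inr i) (a.rel.symm h))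

-- The diagram `a.flip.comp a` consists of the caps of `a`, their mirror images, and vertical
-- strands at the through ends of `a`. Below `b` its mirrored caps only close up caps of `b`.
theorem comp_flip_comp {a b : Diagram n} (h : a.bottomHalf ≤ b.bottomHalf) :
    b.comp (a.flip.comp a) = b := by
  let g := glue b.rel (a.flip.comp a).rel
  have up {i : Fin n} (hi : ∀ j, a.mate (.inl i) ≠ .inl j) :
      g (lower (.inl i)) (upper (.inl i)) := by
    rcases hj : a.mate (.inl i) with j | j
    · exact absurd hj (hi j)
    · exact glue_lower (flip_comp_self_rel (hj ▸ a.rel_mate _))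
  have cap {i j : Fin n} (hj : a.mate (.inl i) = .inl j) : b.mate (.inl i) = .inl j :=
    (eq_mate (hj ▸ a.mate_ne _) (h (x := i) (y := j) (hj ▸ a.rel_mate _ : a.rel _ _))).symm
  have from_bottom (i : Fin n) : g (outer (.inl i)) (outer (b.mate (.inl i))) := by
    by_cases hi : ∃ j, a.mate (.inl i) = .inl j
    · obtain ⟨j, hj⟩ := hi
      rw [cap hj]
      exact glue_lower (p := .inl i) (q := .inl j)
        (bottomHalf_le_comp _ a (hj ▸ a.rel_mate _ : a.rel _ _))
    have step := g.trans (up (not_exists.1 hi)) (glue_upper (b.rel_mate (.inl i)))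
    rcases hj : b.mate (.inl i) with j | j <;> rw [hj] at step
    · refine g.trans step (g.symm (up fun k hk => hi ⟨j, ?_⟩))
      have hki : Sum.inl k = Sum.inl i := (cap hk).symm.trans (by rw [← hj, mate_mate])
      rw [← hki, ← hk, mate_mate]
    · exact step
  refine (eq_of_le fun p q hpq => ?_).symm
  obtain rfl | rfl := rel_iff.1 hpq
  · exact g.refl _
  rcases p with i | i
  · exact from_bottom i
  · rcases hj : b.mate (.inr i) with j | j
    · have := from_bottom j
      rw [← hj, mate_mate] at this
      exact hj ▸ g.symm this
    · exact glue_upper (hj ▸ b.rel_mate _)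

end Diagram

/-- One half of a diagram, considered by itself: a crossingless partial matching of the points
`0, …, n - 1` of a line, no unmatched point of which lies under an arc. It is encoded by the
involution of `ℕ` which exchanges the ends of every arc and fixes all other numbers, including
those beyond `n`. -/
@[ext]
structure HalfDiagram (n : ℕ) where
  mate : ℕ → ℕ
  mate_mate : ∀ x, mate (mate x) = x
  mate_of_le : ∀ x, n ≤ x → mate x = x
  nested : ∀ x y, x < y → y < mate x → x < mate y ∧ mate y < mate x ∧ mate y ≠ y

namespace HalfDiagram

variable (b c : HalfDiagram n)

/-- The number of unmatched points to the left of `x`. -/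
def rank (x : ℕ) : ℕ := Nat.count (fun y => b.mate y = y) x

/-- The number of unmatched points of a half diagram. -/
def defects : ℕ := b.rank n

/-- The unmatched point with `r` unmatched points to its left; it lies beyond the half diagram if
`b.defects ≤ r`. -/
noncomputable def defect (r : ℕ) : ℕ := Nat.nth (fun y => b.mate y = y) r

/-- The relation "lies on the same arc or coincides" on the points of a half diagram. -/
def rel : Setoid (Fin n) where
  r i j := (j : ℕ) = i ∨ (j : ℕ) = b.mate i
  iseqv :=
    { refl := fun _ => .inl rfl
      symm := by
        rintro i j (h | h)
        · exact .inl h.symm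
        · exact .inr (by rw [h, b.mate_mate])
      trans := by
        rintro i j k (hij | hij) (hjk | hjk) <;> rw [hij] at hjk
        · exact .inl hjk
        · exact .inr hjk
        · exact .inr hjk
        · exact .inl (by rw [hjk, b.mate_mate]) }

variable {b c}

theorem mate_injective : Function.Injective b.mate :=
  Function.LeftInverse.injective b.mate_mate

theorem mate_lt {x : ℕ} (hx : x < n) : b.mate x < n := by
  by_contra h
  have := b.mate_of_le _ (not_lt.1 h)
  rw [b.mate_mate] at this
  omega

theorem lt_of_mate_ne {x : ℕ} (hx : b.mate x ≠ x) : x < n :=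
  not_le.1 fun h => hx (b.mate_of_le x h)

theorem infinite_unmatched : {x | b.mate x = x}.Infinite :=
  (Set.Ici_infinite n).mono b.mate_of_le

theorem mate_defect (r : ℕ) : b.mate (b.defect r) = b.defect r :=
  Nat.nth_mem_of_infinite b.infinite_unmatched r

theorem rank_defect (r : ℕ) : b.rank (b.defect r) = r :=
  Nat.count_nth_of_infinite b.infinite_unmatched r

theorem defect_rank {x : ℕ} (hx : b.mate x = x) : b.defect (b.rank x) = x :=
  Nat.nth_count hx

theorem defect_strictMono : StrictMono b.defect :=
  Nat.nth_strictMono b.infinite_unmatched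

theorem defect_lt_iff {r x : ℕ} : b.defect r < x ↔ r < b.rank x :=
  (Nat.lt_nth_iff_count_lt b.infinite_unmatched).symm

theorem rank_lt_rank_iff {x y : ℕ} (hx : b.mate x = x) : b.rank x < b.rank y ↔ x < y := by
  rw [← defect_lt_iff, defect_rank hx]

theorem mate_lt_of_lt_unmatched {x y : ℕ} (hy : b.mate y = y) (hx : x < y) : b.mate x < y := by
  by_contra h
  rcases (not_lt.1 h).lt_or_eq with h | h
  · exact (b.nested x y hx h).2.2 hy
  · rw [h, b.mate_mate] at hy
    omega

theorem unmatched_lt_mate_of_lt {x y : ℕ} (hx : b.mate x = x) (hy : x < y) : x < b.mate y := by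
  by_contra h
  rcases (not_lt.1 h).lt_or_eq with h | h
  · have := mate_lt_of_lt_unmatched hx h
    rw [b.mate_mate] at this
    omega
  · rw [← h, b.mate_mate] at hx
    omega

theorem rank_eq_card (x : ℕ) : b.rank x = {y ∈ Finset.range x | b.mate y = y}.card :=
  Nat.count_eq_card_filter_range _ _

theorem defects_le : b.defects ≤ n := Nat.count_le _

theorem mate_eq_of_rel_le (h : b.rel ≤ c.rel) {x : ℕ} (hx : b.mate x ≠ x) :
    c.mate x = b.mate x := by
  have hxn := lt_of_mate_ne hx
  exact ((h (x := ⟨x, hxn⟩) (y := ⟨b.mate x, mate_lt hxn⟩) (.inr rfl)).resolve_left hx).symm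

theorem mate_eq_self_of_rel_le (h : b.rel ≤ c.rel) {x : ℕ} (hx : c.mate x = x) : b.mate x = x := by
  by_contra hne
  exact hne ((mate_eq_of_rel_le h hne).symm.trans hx)

theorem defects_le_of_rel_le (h : b.rel ≤ c.rel) : c.defects ≤ b.defects :=
  Nat.count_mono_left fun _ _ => mate_eq_self_of_rel_le h

theorem eq_of_rel_le (h : b.rel ≤ c.rel) (hdef : b.defects ≤ c.defects) : b = c := by
  have unmatched_eq :
      {x ∈ Finset.range n | c.mate x = x} = {x ∈ Finset.range n | b.mate x = x} := by
    refine Finset.eq_of_subset_of_card_le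
      (Finset.monotone_filter_right _ fun x _ => mate_eq_self_of_rel_le h) ?_
    rwa [← rank_eq_card, ← rank_eq_card]
  ext x
  by_cases hx : b.mate x = x
  · rcases lt_or_ge x n with hxn | hxn
    · have : x ∈ {x ∈ Finset.range n | c.mate x = x} := by
        rw [unmatched_eq, Finset.mem_filter, Finset.mem_range]
        exact ⟨hxn, hx⟩
      rw [hx, (Finset.mem_filter.1 this).2]
    · rw [hx, c.mate_of_le x hxn]
  · exact (mate_eq_of_rel_le h hx).symm

theorem rel_injective : Function.Injective (rel (n := n)) := fun _ _ h =>
  eq_of_rel_le h.le (defects_le_of_rel_le h.ge)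

instance : Finite (HalfDiagram n) :=
  have : Finite (Setoid (Fin n)) := Finite.of_injective
    (fun s i j => s i j) fun _ _ h => Setoid.ext fun i j => iff_of_eq (congrFun₂ h i j)
  Finite.of_injective rel rel_injective

/-- The half diagram without arcs. -/
protected def id (n : ℕ) : HalfDiagram n where
  mate := _root_.id
  mate_mate _ := rfl
  mate_of_le _ _ := rfl
  nested _ _ hxy hyx := absurd hxy hyx.asymm

theorem defects_id : (HalfDiagram.id n).defects = n := Nat.count_of_forall fun _ _ => rfl

/-- The half diagram with a further unmatched point at its right end. -/
def castSucc (b : HalfDiagram n) : HalfDiagram (n + 1) where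
  mate := b.mate
  mate_mate := b.mate_mate
  mate_of_le x hx := b.mate_of_le x (by omega)
  nested := b.nested

theorem defects_castSucc : b.castSucc.defects = b.defects + 1 := by
  have hn : b.castSucc.mate n = n := b.mate_of_le n le_rfl
  rw [defects, rank, Nat.count_succ, if_pos hn]
  rfl

variable {b : HalfDiagram n} {r : ℕ}

theorem mate_ne_of_lt_defect_succ {x : ℕ} (hr : b.defect r < x) (hr' : x < b.defect (r + 1)) :
    b.mate x ≠ x := fun hx => by
  have : x ≤ b.defect r := Nat.le_nth_of_lt_nth_succ hr' hx
  omega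

/-- The half diagram with the unmatched points number `r` and `r + 1` joined by a new arc. -/
noncomputable def join (b : HalfDiagram n) (r : ℕ) (h : r + 1 < b.defects) : HalfDiagram n where
  mate x := b.mate (Equiv.swap (b.defect r) (b.defect (r + 1)) x)
  mate_mate x := by
    have hp := b.mate_defect r
    have hq := b.mate_defect (r + 1)
    by_cases hxp : x = b.defect r
    · rw [hxp, Equiv.swap_apply_left, hq, Equiv.swap_apply_right, hp]
    by_cases hxq : x = b.defect (r + 1)
    · rw [hxq, Equiv.swap_apply_right, hp, Equiv.swap_apply_left, hq]
    rw [Equiv.swap_apply_of_ne_of_ne hxp hxq, Equiv.swap_apply_of_ne_of_ne, b.mate_mate]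
    · exact fun h => hxp (b.mate_injective (h.trans hp.symm))
    · exact fun h => hxq (b.mate_injective (h.trans hq.symm))
  mate_of_le x hx := by
    have hp : b.defect r < n := defect_lt_iff.2 (Nat.lt_of_succ_lt h)
    have hq : b.defect (r + 1) < n := defect_lt_iff.2 h
    rw [Equiv.swap_apply_of_ne_of_ne (by omega) (by omega), b.mate_of_le x hx]
  nested x y hxy hyx := by
    have hp := b.mate_defect r
    have hq := b.mate_defect (r + 1)
    have hpq : b.defect r < b.defect (r + 1) := defect_strictMono r.lt_succ_self
    by_cases hxp : x = b.defect r
    · rw [hxp, Equiv.swap_apply_left, hq] at hyx ⊢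
      rw [hxp] at hxy
      rw [Equiv.swap_apply_of_ne_of_ne (by omega) (by omega)]
      exact ⟨unmatched_lt_mate_of_lt hp hxy, mate_lt_of_lt_unmatched hq hyx,
        mate_ne_of_lt_defect_succ hxy hyx⟩
    by_cases hxq : x = b.defect (r + 1)
    · rw [hxq, Equiv.swap_apply_right, hp] at hyx
      omega
    rw [Equiv.swap_apply_of_ne_of_ne hxp hxq] at hyx ⊢
    have hy := b.nested x y hxy hyx
    rwa [Equiv.swap_apply_of_ne_of_ne]
    · rintro rfl
      exact hy.2.2 hp
    · rintro rfl
      exact hy.2.2 hq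

theorem join_mate_defect (h : r + 1 < b.defects) :
    (b.join r h).mate (b.defect r) = b.defect (r + 1) := by
  change b.mate (Equiv.swap _ _ _) = _
  rw [Equiv.swap_apply_left, mate_defect]

theorem rel_le_rel_join (h : r + 1 < b.defects) : b.rel ≤ (b.join r h).rel := by
  rintro i j (hij | hij)
  · exact .inl hij
  by_cases hi : b.mate i = i
  · exact .inl (hij.trans hi)
  · refine .inr (hij.trans (congrArg b.mate (Equiv.swap_apply_of_ne_of_ne ?_ ?_)).symm) <;>
      exact fun h => hi (h ▸ b.mate_defect _)

theorem defects_join (h : r + 1 < b.defects) : (b.join r h).defects + 2 = b.defects := by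
  have hpq : b.defect r < b.defect (r + 1) := defect_strictMono r.lt_succ_self
  have hq : b.defect (r + 1) < n := defect_lt_iff.2 h
  have unmatched_eq : {x ∈ Finset.range n | b.mate x = x} =
      insert (b.defect r) (insert (b.defect (r + 1))
        {x ∈ Finset.range n | (b.join r h).mate x = x}) := by
    ext x
    simp only [Finset.mem_insert, Finset.mem_filter, Finset.mem_range]
    by_cases hxp : x = b.defect r
    · simp only [hxp, mate_defect, hpq.trans hq, true_or, and_self]
    by_cases hxq : x = b.defect (r + 1)
    · simp only [hxq, mate_defect, hq, true_or, or_true, and_self]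
    simp only [hxp, hxq, false_or, join, Equiv.swap_apply_of_ne_of_ne hxp hxq]
  have hp : (b.join r h).mate (b.defect r) ≠ b.defect r := (join_mate_defect h).trans_ne hpq.ne'
  have hq : (b.join r h).mate (b.defect (r + 1)) ≠ b.defect (r + 1) := by
    rw [← join_mate_defect h, mate_mate, join_mate_defect h]
    exact hpq.ne
  rw [defects, defects, rank_eq_card, rank_eq_card, unmatched_eq, Finset.card_insert_of_notMem,
    Finset.card_insert_of_notMem]
  · simp only [Finset.mem_filter, hq, and_false, not_false_eq_true]
  · simp only [Finset.mem_insert, Finset.mem_filter, hp, hpq.ne, and_false, or_self,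
      not_false_eq_true]

theorem exists_rel_le_defects_eq (b : HalfDiagram n) {l : ℕ} (hl : l ≤ b.defects)
    (hmod : l ≡ b.defects [MOD 2]) : ∃ c : HalfDiagram n, b.rel ≤ c.rel ∧ c.defects = l := by
  induction hk : b.defects using Nat.strong_induction_on generalizing b with
  | _ k ih =>
    subst hk
    rcases hl.eq_or_lt with rfl | hlt
    · exact ⟨b, le_rfl, rfl⟩
    have h : 0 + 1 < b.defects := by
      unfold Nat.ModEq at hmod
      omega
    have hjoin := defects_join h
    unfold Nat.ModEq at hmod
    obtain ⟨c, hle, hc⟩ := ih _ (by omega) (b.join 0 h) (by omega)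
      (by unfold Nat.ModEq; omega) rfl
    exact ⟨c, (rel_le_rel_join h).trans hle, hc⟩

/-- The half diagram left after the deletion of the last point, whose arc, if any, is opened. -/
def removeLast (c : HalfDiagram (n + 1)) : HalfDiagram n where
  mate x := c.mate (Equiv.swap (c.mate n) n x)
  mate_mate x := by
    by_cases hxn : x = n
    · rw [hxn, Equiv.swap_apply_right, c.mate_mate, Equiv.swap_apply_right, c.mate_mate]
    by_cases hxj : x = c.mate n
    · rw [hxj, Equiv.swap_apply_left, Equiv.swap_apply_left]
    rw [Equiv.swap_apply_of_ne_of_ne hxj hxn, Equiv.swap_apply_of_ne_of_ne, c.mate_mate]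
    · exact fun h => hxn (c.mate_injective h)
    · exact fun h => hxj ((c.mate_mate x).symm.trans (congrArg c.mate h))
  mate_of_le x hx := by
    rcases hx.eq_or_lt with rfl | hlt
    · rw [Equiv.swap_apply_right, c.mate_mate]
    have := c.mate_lt n.lt_succ_self
    rw [Equiv.swap_apply_of_ne_of_ne (by omega) (by omega), c.mate_of_le x hlt]
  nested x y hxy hyx := by
    by_cases hxn : x = n
    · rw [hxn, Equiv.swap_apply_right, c.mate_mate] at hyx
      omega
    by_cases hxj : x = c.mate n
    · rw [hxj, Equiv.swap_apply_left] at hyx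
      omega
    rw [Equiv.swap_apply_of_ne_of_ne hxj hxn] at hyx ⊢
    have hx : c.mate x < n + 1 := c.mate_lt (lt_of_mate_ne (hxy.trans hyx).ne')
    have hy := c.nested x y hxy hyx
    rwa [Equiv.swap_apply_of_ne_of_ne]
    · rintro rfl
      rw [c.mate_mate] at hy
      omega
    · omega

variable {c : HalfDiagram (n + 1)}

theorem removeLast_mate_of_ne {x : ℕ} (hxj : x ≠ c.mate n) (hxn : x ≠ n) :
    c.removeLast.mate x = c.mate x :=
  congrArg c.mate (Equiv.swap_apply_of_ne_of_ne hxj hxn)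

theorem removeLast_mate_mate : c.removeLast.mate (c.mate n) = c.mate n :=
  congrArg c.mate (Equiv.swap_apply_left _ _)

theorem castSucc_removeLast (hn : c.mate n = n) : c.removeLast.castSucc = c := by
  ext x
  change c.mate (Equiv.swap (c.mate n) n x) = c.mate x
  rw [hn, Equiv.swap_self, Equiv.refl_apply]

theorem removeLast_castSucc : b.castSucc.removeLast = b := by
  ext x
  change b.mate (Equiv.swap (b.mate n) n x) = b.mate x
  rw [b.mate_of_le n le_rfl, Equiv.swap_self, Equiv.refl_apply]

theorem removeLast_mate_swap (x : ℕ) :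
    c.removeLast.mate (Equiv.swap (c.mate n) n x) = c.mate x :=
  congrArg c.mate (Equiv.swap_apply_self _ _ _)

theorem mate_last_lt (hn : c.mate n ≠ n) : c.mate n < n := by
  have := c.mate_lt n.lt_succ_self
  omega

theorem defects_removeLast (hn : c.mate n ≠ n) : c.removeLast.defects = c.defects + 1 := by
  have hj := mate_last_lt hn
  have unmatched_eq : {x ∈ Finset.range n | c.removeLast.mate x = x} =
      insert (c.mate n) {x ∈ Finset.range (n + 1) | c.mate x = x} := by
    ext x
    simp only [Finset.mem_insert, Finset.mem_filter, Finset.mem_range]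
    by_cases hxj : x = c.mate n
    · simp only [hxj, removeLast_mate_mate, hj, and_self, true_or]
    by_cases hxn : x = n
    · simp only [hxn, hn, hn.symm, lt_irrefl, false_and, and_false, or_self]
    rw [removeLast_mate_of_ne hxj hxn]
    omega
  rw [defects, defects, rank_eq_card, rank_eq_card, unmatched_eq, Finset.card_insert_of_notMem]
  simp only [Finset.mem_filter, c.mate_mate, hn.symm, and_false, not_false_eq_true]

-- No point below the arc at the last point is unmatched.
theorem removeLast_defect_defects (hn : c.mate n ≠ n) :
    c.removeLast.defect c.defects = c.mate n := by
  have hj := mate_last_lt hn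
  set q := c.removeLast.defect c.defects with hq_def
  have hqn : q < n := defect_lt_iff.2 ((Nat.lt_succ_self _).trans_eq (defects_removeLast hn).symm)
  have hjq : c.mate n ≤ q := by
    rw [← defect_rank (b := c.removeLast) removeLast_mate_mate, hq_def,
      defect_strictMono.le_iff_le, ← Nat.lt_succ_iff]
    exact ((rank_lt_rank_iff removeLast_mate_mate).2 hj).trans_eq (defects_removeLast hn)
  refine (hjq.eq_or_lt.resolve_right fun hlt => ?_).symm
  have hq : c.mate q ≠ q := (c.nested (c.mate n) q hlt (by rwa [c.mate_mate])).2.2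
  rw [← removeLast_mate_of_ne hlt.ne' hqn.ne] at hq
  exact hq (mate_defect _)

theorem eq_of_removeLast_eq {c' : HalfDiagram (n + 1)} (hn : c.mate n ≠ n) (hn' : c'.mate n ≠ n)
    (hdef : c.defects = c'.defects) (h : c.removeLast = c'.removeLast) : c = c' := by
  have hj : c.mate n = c'.mate n := by
    rw [← removeLast_defect_defects hn, ← removeLast_defect_defects hn', hdef, h]
  ext x
  rw [← c.removeLast_mate_swap, ← c'.removeLast_mate_swap, hj, h]

theorem exists_removeLast_eq (b : HalfDiagram n) {k : ℕ} (hk : b.defects = k + 1) :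
    ∃ c : HalfDiagram (n + 1), c.mate n ≠ n ∧ c.defects = k ∧ c.removeLast = b := by
  have h : k + 1 < b.castSucc.defects := by
    rw [defects_castSucc]
    omega
  have hq : b.castSucc.defect (k + 1) = n := by
    rw [← hk]
    exact defect_rank (b := b.castSucc) (b.mate_of_le n le_rfl)
  have hp : b.castSucc.defect k < n := (defect_strictMono k.lt_succ_self).trans_eq hq
  have hjoin : (b.castSucc.join k h).mate n = b.castSucc.defect k := by
    refine (congrArg (b.castSucc.join k h).mate hq.symm).trans ?_
    rw [← join_mate_defect h, mate_mate]
  refine ⟨b.castSucc.join k h, hjoin ▸ hp.ne, ?_, ?_⟩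
  · have := defects_join h
    rw [defects_castSucc] at this
    omega
  · ext x
    change b.mate (Equiv.swap _ _ (Equiv.swap ((b.castSucc.join k h).mate n) n x)) = b.mate x
    rw [hjoin, hq, Equiv.swap_apply_self]

theorem defects_modEq (b : HalfDiagram n) : b.defects ≡ n [MOD 2] := by
  induction n with
  | zero => exact (Nat.le_zero.1 b.defects_le).symm ▸ rfl
  | succ n ih =>
    have := ih b.removeLast
    by_cases hn : b.mate n = n
    · have hdef := b.removeLast.defects_castSucc
      rw [castSucc_removeLast hn] at hdef
      rw [hdef]
      exact this.add_right 1
    · rw [defects_removeLast hn] at this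
      unfold Nat.ModEq at this ⊢
      omega

end HalfDiagram

open HalfDiagram

/-- The number of half diagrams with `k` unmatched points among `n`. -/
noncomputable def halfCount (n k : ℕ) : ℕ := {b : HalfDiagram n | b.defects = k}.ncard

theorem halfCount_eq_zero_of_lt {k : ℕ} (h : n < k) : halfCount n k = 0 := by
  rw [halfCount, Set.ncard_eq_zero]
  exact Set.eq_empty_of_forall_notMem fun b hb => h.not_ge (hb ▸ b.defects_le)

theorem halfCount_zero_zero : halfCount 0 0 = 1 := by
  rw [halfCount, Set.ncard_eq_one]
  refine ⟨HalfDiagram.id 0, Set.eq_singleton_iff_unique_mem.2 ⟨defects_id, fun b _ => ?_⟩⟩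
  ext x
  exact b.mate_of_le x x.zero_le

theorem ncard_unmatched_last (k : ℕ) :
    {c : HalfDiagram (n + 1) | c.defects = k + 1 ∧ c.mate n = n}.ncard = halfCount n k := by
  refine (Set.BijOn.ncard_eq (f := castSucc) ⟨?_, ?_, ?_⟩).symm
  · exact fun b hb => ⟨b.defects_castSucc.trans (congrArg (· + 1) hb), b.mate_of_le n le_rfl⟩
  · exact Function.LeftInverse.injective (fun _ => removeLast_castSucc) |>.injOn
  · rintro c ⟨hk, hn⟩
    have hc := castSucc_removeLast hn
    refine ⟨c.removeLast, ?_, hc⟩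
    rw [← hc, defects_castSucc] at hk
    exact Nat.succ_injective hk

theorem ncard_matched_last (k : ℕ) :
    {c : HalfDiagram (n + 1) | c.defects = k ∧ c.mate n ≠ n}.ncard = halfCount n (k + 1) := by
  refine Set.BijOn.ncard_eq (f := removeLast) ⟨?_, ?_, ?_⟩
  · rintro c ⟨rfl, hn⟩
    exact defects_removeLast hn
  · rintro c ⟨hk, hn⟩ c' ⟨hk', hn'⟩ h
    exact eq_of_removeLast_eq hn hn' (hk.trans hk'.symm) h
  · intro b hb
    obtain ⟨c, hn, hk, hc⟩ := b.exists_removeLast_eq hb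
    exact ⟨c, ⟨hk, hn⟩, hc⟩

theorem halfCount_succ_zero (n : ℕ) : halfCount (n + 1) 0 = halfCount n 1 := by
  rw [← ncard_matched_last, halfCount]
  congr 1
  ext c
  refine (and_iff_left_of_imp fun hc hn => ?_).symm
  rw [Set.mem_ofPred_eq, ← castSucc_removeLast hn, defects_castSucc] at hc
  exact Nat.succ_ne_zero _ hc

theorem halfCount_succ_succ (n k : ℕ) :
    halfCount (n + 1) (k + 1) = halfCount n k + halfCount n (k + 2) := by
  rw [halfCount, ← ncard_unmatched_last k, ← ncard_matched_last (k + 1), ← Set.ncard_union_eq]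
  · congr 1
    ext c
    simp only [Set.mem_union, Set.mem_ofPred_eq, ← and_or_left, ne_eq, em, and_true]
  · exact Set.disjoint_left.2 fun c hc hc' => hc'.2 hc.2

theorem halfCount_mul {k c : ℕ} (h : n = k + 2 * c) :
    halfCount n k * (k + c + 1) = (k + 1) * n.choose c := by
  induction n generalizing k c with
  | zero =>
    obtain ⟨rfl, rfl⟩ : k = 0 ∧ c = 0 := by omega
    rw [halfCount_zero_zero, Nat.choose_self]
  | succ n ih =>
    rcases k with _ | k
    · obtain ⟨c, rfl⟩ : ∃ d, c = d + 1 := ⟨c - 1, by omega⟩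
      have hk := ih (k := 1) (c := c) (by omega)
      have hsymm : n.choose (c + 1) = n.choose c := Nat.choose_symm_of_eq_add (by omega)
      rw [Nat.choose_succ_succ, hsymm, halfCount_succ_zero]
      linarith
    have hk := ih (k := k) (c := c) (by omega)
    rcases c with _ | c
    · rw [halfCount_succ_succ, halfCount_eq_zero_of_lt (by omega : n < k + 2)]
      rw [Nat.choose_zero_right] at hk ⊢
      have : halfCount n k = 1 := Nat.eq_of_mul_eq_mul_right k.succ_pos (by simpa using hk)
      rw [this]
      ring
    · have hk' := ih (k := k + 2) (c := c) (by omega)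
      have hchoose := Nat.choose_succ_right_eq n c
      rw [show n - c = k + c + 2 by omega] at hchoose
      rw [halfCount_succ_succ, Nat.choose_succ_succ]
      apply Nat.eq_of_mul_eq_mul_right (show 0 < k + c + 2 by omega)
      zify at hk hk' hchoose ⊢
      linear_combination (k + c + 3 : ℤ) * hk + (k + c + 2 : ℤ) * hk' - hchoose

theorem eq_add_two_mul_capNumber {k : ℕ} (hk : k ≤ n) (hmod : k ≡ n [MOD 2]) :
    n = k + 2 * capNumber n k := by
  unfold Nat.ModEq at hmod
  unfold capNumber
  omega

theorem halfCount_eq {k : ℕ} (hk : k ≤ n) (hmod : k ≡ n [MOD 2]) : (halfCount n k : ℚ) =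
    ((k : ℚ) + 1) / ((n : ℚ) - (capNumber n k : ℚ) + 1) * (n.choose (capNumber n k) : ℚ) := by
  have hn := eq_add_two_mul_capNumber hk hmod
  have hden : (n : ℚ) - (capNumber n k : ℚ) + 1 = k + capNumber n k + 1 := by
    have : (n : ℚ) = k + 2 * capNumber n k := by exact_mod_cast hn
    linear_combination this
  rw [hden, div_mul_eq_mul_div, eq_div_iff (by positivity)]
  exact_mod_cast halfCount_mul hn

namespace Diagram

variable {d d' : Diagram n} {i j : Fin n}

theorem top_mate_of_bottom_mate (h : d.mate (.inl i) = .inr j) :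
    d.flip.mate (.inl j) = .inr i := by
  rw [flip_mate]
  change (d.mate (.inr j)).swap = _
  rw [← h, mate_mate, Sum.swap_inl]

/-- The cap of a diagram at the bottom point number `x`, as an involution of `ℕ` which fixes
the bottom ends of through strands and the numbers beyond `n`. -/
noncomputable def capMate (d : Diagram n) (x : ℕ) : ℕ :=
  if h : x < n then Sum.elim (fun j : Fin n => (j : ℕ)) (fun _ => x) (d.mate (.inl ⟨x, h⟩)) else x

theorem capMate_of_le {x : ℕ} (h : n ≤ x) : d.capMate x = x := dif_neg h.not_gt

theorem capMate_of_eq_inl (h : d.mate (.inl i) = .inl j) : d.capMate i = j := by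
  rw [capMate, dif_pos i.2, h, Sum.elim_inl]

theorem capMate_of_eq_inr (h : d.mate (.inl i) = .inr j) : d.capMate i = i := by
  rw [capMate, dif_pos i.2, h, Sum.elim_inr]

theorem exists_of_capMate_ne {x : ℕ} (h : d.capMate x ≠ x) :
    ∃ i j : Fin n, x = i ∧ d.mate (.inl i) = .inl j := by
  have hx : x < n := not_le.1 fun hx => h (capMate_of_le hx)
  rcases hj : d.mate (.inl ⟨x, hx⟩) with j | j
  · exact ⟨⟨x, hx⟩, j, rfl, hj⟩
  · exact absurd (capMate_of_eq_inr hj) h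

/-- The bottom half of a diagram, as a half diagram. -/
noncomputable def bottom (d : Diagram n) : HalfDiagram n where
  mate := d.capMate
  mate_mate x := by
    by_cases hx : d.capMate x = x
    · rw [hx, hx]
    obtain ⟨i, j, rfl, hj⟩ := exists_of_capMate_ne hx
    rw [capMate_of_eq_inl hj]
    exact capMate_of_eq_inl (hj ▸ d.mate_mate _)
  mate_of_le _ := capMate_of_le
  nested x y hxy hyx := by
    obtain ⟨i, j, rfl, hj⟩ := exists_of_capMate_ne (hxy.trans hyx).ne'
    rw [capMate_of_eq_inl hj] at hyx ⊢
    have hyn : y < n := hyx.trans j.2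
    obtain ⟨h, h'⟩ := nested (p := .inl i) (q := .inl ⟨y, hyn⟩) hxy (by rwa [hj])
    rw [hj] at h'
    rcases hk : d.mate (.inl ⟨y, hyn⟩) with k | k <;> rw [hk] at h h'
    · rw [capMate_of_eq_inl (i := ⟨y, hyn⟩) hk]
      refine ⟨h, h', fun hky => d.mate_ne (.inl ⟨y, hyn⟩) (hk.trans ?_)⟩
      exact congrArg Sum.inl (Fin.ext hky)
    · have := pos_inr_add k
      change pos (.inr k) < (j : ℕ) at h'
      omega

/-- The top half of a diagram, as a half diagram. -/
noncomputable def top (d : Diagram n) : HalfDiagram n := d.flip.bottom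

theorem rel_bottom (d : Diagram n) : d.bottom.rel = d.bottomHalf := by
  ext i j
  change (j : ℕ) = i ∨ (j : ℕ) = d.capMate i ↔ d.rel (.inl i) (.inl j)
  rw [rel_iff, Sum.inl_injective.eq_iff, Fin.ext_iff]
  rcases hk : d.mate (.inl i) with k | k
  · rw [capMate_of_eq_inl hk, Sum.inl_injective.eq_iff, Fin.ext_iff]
  · rw [capMate_of_eq_inr hk, or_self, or_iff_left Sum.inl_ne_inr]

theorem rel_top (d : Diagram n) : d.top.rel = d.topHalf := d.flip.rel_bottom

theorem bottom_flip (d : Diagram n) : d.flip.bottom = d.top := rfl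

theorem top_flip (d : Diagram n) : d.flip.top = d.bottom := congrArg bottom d.flip_flip

theorem exists_mate_inl_of_bottom_mate_eq {x : ℕ} (hx : x < n) (h : d.bottom.mate x = x) :
    ∃ j, d.mate (.inl ⟨x, hx⟩) = .inr j := by
  rcases hj : d.mate (.inl ⟨x, hx⟩) with j | j
  · have hjx : (j : ℕ) = x := (capMate_of_eq_inl hj).symm.trans h
    exact absurd (hj.trans (congrArg Sum.inl (Fin.ext hjx))) (d.mate_ne _)
  · exact ⟨j, rfl⟩

theorem bottom_mate_eq_iff : d.bottom.mate i = i ↔ ∃ j, d.rel (.inl i) (.inr j) := by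
  refine ⟨fun h => ?_, fun ⟨j, h⟩ => capMate_of_eq_inr (eq_mate Sum.inr_ne_inl h).symm⟩
  obtain ⟨j, hj⟩ := exists_mate_inl_of_bottom_mate_eq i.2 h
  exact ⟨j, hj ▸ d.rel_mate _⟩

theorem through_eq_defects_bottom (d : Diagram n) : d.through = d.bottom.defects := by
  rw [through, defects, rank_eq_card, ← Set.ncard_coe_finset]
  refine Set.BijOn.ncard_eq (f := Fin.val) ⟨fun i hi => ?_, Fin.val_injective.injOn, fun x hx => ?_⟩
  · exact Finset.mem_filter.2 ⟨Finset.mem_range.2 i.2, bottom_mate_eq_iff.2 hi⟩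
  · obtain ⟨hxn, hx⟩ := Finset.mem_filter.1 hx
    exact ⟨⟨x, Finset.mem_range.1 hxn⟩, bottom_mate_eq_iff.1 hx, rfl⟩

theorem rank_bottom_le_rank_top {x y : ℕ} (hx : x ≤ n)
    (h : ∀ i j : Fin n, d.mate (.inl i) = .inr j → (i : ℕ) < x → (j : ℕ) < y) :
    d.bottom.rank x ≤ d.top.rank y := by
  rw [rank_eq_card, rank_eq_card]
  refine Finset.card_le_card_of_forall_subsingleton
    (fun u v : ℕ => ∃ i j : Fin n, u = i ∧ v = j ∧ d.mate (.inl i) = .inr j) (fun u hu => ?_) ?_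
  · obtain ⟨hux, hu⟩ := Finset.mem_filter.1 hu
    have hux := Finset.mem_range.1 hux
    obtain ⟨j, hj⟩ := exists_mate_inl_of_bottom_mate_eq (hux.trans_le hx) hu
    exact ⟨j, Finset.mem_filter.2 ⟨Finset.mem_range.2 (h _ j hj hux),
      capMate_of_eq_inr (top_mate_of_bottom_mate hj)⟩, _, j, rfl, rfl, hj⟩
  · rintro v - _ ⟨-, i, j, rfl, rfl, hij⟩ _ ⟨-, i', j', rfl, hjj', hij'⟩
    obtain rfl := Fin.ext hjj'
    exact congrArg Fin.val (Sum.inr_injective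
      ((top_mate_of_bottom_mate hij).symm.trans (top_mate_of_bottom_mate hij')))

theorem defects_bottom_le_defects_top (d : Diagram n) : d.bottom.defects ≤ d.top.defects :=
  rank_bottom_le_rank_top le_rfl fun _ j _ _ => j.2

theorem defects_bottom_eq_defects_top (d : Diagram n) : d.bottom.defects = d.top.defects :=
  d.defects_bottom_le_defects_top.antisymm
    (d.flip.defects_bottom_le_defects_top.trans_eq (congrArg defects d.top_flip))

theorem rank_bottom_le_of_mate (h : d.mate (.inl i) = .inr j) : d.bottom.rank i ≤ d.top.rank j := by
  refine rank_bottom_le_rank_top i.2.le fun i' j' h' hi' => not_le.1 fun hj => ?_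
  have := pos_inr_add j
  have := pos_inr_add j'
  have hnested := nested (p := .inl i') (q := .inl i) hi' (by rw [h']; change (i : ℕ) < _; omega)
  rw [h, h'] at hnested
  omega

theorem rank_bottom_eq_rank_top (h : d.mate (.inl i) = .inr j) :
    d.bottom.rank i = d.top.rank j :=
  (rank_bottom_le_of_mate h).antisymm ((rank_bottom_le_of_mate (top_mate_of_bottom_mate h)).trans_eq
    (congrArg (rank · i) d.top_flip))

theorem eq_defect_of_mate (h : d.mate (.inl i) = .inr j) :
    (j : ℕ) = d.top.defect (d.bottom.rank i) := by
  rw [rank_bottom_eq_rank_top h, defect_rank (capMate_of_eq_inr (top_mate_of_bottom_mate h))]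

theorem mate_inl_eq_of_halves (hb : d.bottom = d'.bottom) (ht : d.top = d'.top) (i : Fin n) :
    d.mate (.inl i) = d'.mate (.inl i) := by
  rcases hj : d.mate (.inl i) with j | j
  · have hrel : d.bottom.rel i j := d.rel_bottom ▸ (hj ▸ d.rel_mate _ : d.rel _ _)
    rw [hb, rel_bottom] at hrel
    exact eq_mate (hj ▸ d.mate_ne _) hrel
  · have hi : d.bottom.mate i = i := capMate_of_eq_inr hj
    obtain ⟨j', hj'⟩ := exists_mate_inl_of_bottom_mate_eq i.2 (hb ▸ hi)
    refine .trans (congrArg Sum.inr (Fin.ext ?_)) hj'.symm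
    rw [eq_defect_of_mate hj, eq_defect_of_mate hj', hb, ht]

theorem eq_of_halves (hb : d.bottom = d'.bottom) (ht : d.top = d'.top) : d = d' := by
  refine eq_of_le fun p q hpq => ?_
  suffices hmate : d.mate p = d'.mate p by rwa [rel_iff, ← hmate, ← rel_iff]
  rcases p with i | i
  · exact mate_inl_eq_of_halves hb ht i
  · have hflip := mate_inl_eq_of_halves (d := d.flip) (d' := d'.flip) ht
      (by rw [top_flip, top_flip, hb]) i
    rw [flip_mate, flip_mate] at hflip
    exact Sum.swap_leftInverse.injective hflip

/-- The diagram whose strands join every point to its image under `μ`. -/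
def ofMate (μ : Pt n → Pt n) (μ_ne : ∀ p, μ p ≠ p) (μ_μ : ∀ p, μ (μ p) = p)
    (nested : ∀ p q, pos p < pos q → pos q < pos (μ p) → pos (μ q) < pos (μ p)) : Diagram n where
  rel :=
    { r p q := q = p ∨ q = μ p
      iseqv :=
        { refl _ := .inl rfl
          symm := by
            rintro p q (rfl | rfl)
            · exact .inl rfl
            · exact .inr (μ_μ p).symm
          trans := by
            rintro p q s (rfl | rfl) (rfl | rfl)
            · exact .inl rfl
            · exact .inr rfl
            · exact .inr rfl
            · exact .inl (μ_μ p) } }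
  isCrossingless :=
    { existsUnique_mate p := ⟨μ p, ⟨μ_ne p, .inr rfl⟩, fun _ h => h.2.resolve_left h.1⟩
      noncrossing p q p' q' hpq hqp' hpq' hp hq := by
        obtain rfl | rfl := hp
        · exact hpq.asymm hqp'
        obtain rfl | rfl := hq
        · exact hqp'.asymm hpq'
        exact hpq'.asymm (nested p q hpq hqp') }

section OfHalves

theorem defect_rank_lt {b t : HalfDiagram n} (h : b.defects = t.defects) {i : Fin n}
    (hi : b.mate i = i) : t.defect (b.rank i) < n :=
  defect_lt_iff.2 (((rank_lt_rank_iff hi).2 i.2).trans_eq h)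

/-- The other end of the strand at the bottom point number `i` in the diagram with bottom half `b`
and top half `t`: as through strands do not cross, an unmatched point of `b` is joined to the
unmatched point of `t` of the same rank. -/
noncomputable def bottomMate (b t : HalfDiagram n) (h : b.defects = t.defects) (i : Fin n) : Pt n :=
  if hi : b.mate i = i then .inr ⟨t.defect (b.rank i), defect_rank_lt h hi⟩
  else .inl ⟨b.mate i, mate_lt i.2⟩

/-- The other end of the strand at a boundary point in the diagram with bottom half `b` and top
half `t`. -/
noncomputable def halvesMate (b t : HalfDiagram n) (h : b.defects = t.defects) : Pt n → Pt n :=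
  Sum.elim (bottomMate b t h) fun j => (bottomMate t b h.symm j).swap

variable {b t : HalfDiagram n} (h : b.defects = t.defects)

theorem halvesMate_swap (p : Pt n) :
    halvesMate b t h p.swap = (halvesMate t b h.symm p).swap := by
  rcases p with i | i
  · rfl
  · exact (Sum.swap_swap _).symm

theorem halvesMate_of_eq {i : Fin n} (hi : b.mate i = i) :
    halvesMate b t h (.inl i) = .inr ⟨t.defect (b.rank i), defect_rank_lt h hi⟩ :=
  dif_pos hi

theorem halvesMate_of_ne {i : Fin n} (hi : b.mate i ≠ i) :
    halvesMate b t h (.inl i) = .inl ⟨b.mate i, mate_lt i.2⟩ :=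
  dif_neg hi

theorem halvesMate_inr_of_eq {j : Fin n} (hj : t.mate j = j) :
    halvesMate b t h (.inr j) = .inl ⟨b.defect (t.rank j), defect_rank_lt h.symm hj⟩ :=
  congrArg Sum.swap (halvesMate_of_eq h.symm hj)

theorem halvesMate_inr_of_ne {j : Fin n} (hj : t.mate j ≠ j) :
    halvesMate b t h (.inr j) = .inr ⟨t.mate j, mate_lt j.2⟩ :=
  congrArg Sum.swap (halvesMate_of_ne h.symm hj)

theorem halvesMate_inl_ne (i : Fin n) : halvesMate b t h (.inl i) ≠ .inl i := by
  by_cases hi : b.mate i = i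
  · rw [halvesMate_of_eq h hi]
    exact Sum.inr_ne_inl
  · rw [halvesMate_of_ne h hi]
    exact fun heq => hi (congrArg Fin.val (Sum.inl_injective heq))

theorem halvesMate_ne (p : Pt n) : halvesMate b t h p ≠ p := by
  rcases p with i | j
  · exact halvesMate_inl_ne h i
  · intro hj
    exact halvesMate_inl_ne h.symm j
      ((halvesMate_swap h.symm (.inr j)).trans (congrArg Sum.swap hj))

theorem halvesMate_halvesMate_inl (i : Fin n) :
    halvesMate b t h (halvesMate b t h (.inl i)) = .inl i := by
  by_cases hi : b.mate i = i
  · rw [halvesMate_of_eq h hi, halvesMate_inr_of_eq h (t.mate_defect _)]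
    exact congrArg Sum.inl (Fin.ext ((congrArg b.defect (t.rank_defect _)).trans (defect_rank hi)))
  · rw [halvesMate_of_ne h hi, halvesMate_of_ne h (b.mate_injective.ne hi)]
    exact congrArg Sum.inl (Fin.ext (b.mate_mate i))

theorem halvesMate_halvesMate (p : Pt n) : halvesMate b t h (halvesMate b t h p) = p := by
  rcases p with i | j
  · exact halvesMate_halvesMate_inl h i
  · have := congrArg Sum.swap (halvesMate_halvesMate_inl h.symm j)
    rwa [← halvesMate_swap, ← halvesMate_swap] at this

theorem halvesMate_nested_inl_inl {i j : Fin n} (hij : i < j)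
    (hj : pos (.inl j) < pos (halvesMate b t h (.inl i))) :
    pos (halvesMate b t h (.inl j)) < pos (halvesMate b t h (.inl i)) := by
  by_cases hi : b.mate i = i
  · rw [halvesMate_of_eq h hi]
    have hi_pos := pos_inr_mk_add (defect_rank_lt h hi)
    have hi_lt := defect_rank_lt h hi
    by_cases hj' : b.mate j = j
    · rw [halvesMate_of_eq h hj']
      have hj_pos := pos_inr_mk_add (defect_rank_lt h hj')
      have := t.defect_strictMono ((rank_lt_rank_iff hi).2 hij)
      omega
    · rw [halvesMate_of_ne h hj']
      have := b.mate_lt j.2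
      change b.mate j < _
      omega
  · rw [halvesMate_of_ne h hi] at hj ⊢
    have hnested := b.nested i j hij hj
    rw [halvesMate_of_ne h hnested.2.2]
    exact hnested.2.1

theorem halvesMate_nested_inl_inr {i j : Fin n}
    (hj : pos (.inr j) < pos (halvesMate b t h (.inl i))) :
    pos (halvesMate b t h (.inr j)) < pos (halvesMate b t h (.inl i)) := by
  have hj_pos := pos_inr_add j
  by_cases hi : b.mate i = i
  · rw [halvesMate_of_eq h hi] at hj ⊢
    have hi_pos := pos_inr_mk_add (defect_rank_lt h hi)
    by_cases hj' : t.mate j = j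
    · rw [halvesMate_inr_of_eq h hj']
      have := defect_rank_lt h.symm hj'
      change b.defect _ < _
      omega
    · rw [halvesMate_inr_of_ne h hj']
      have hmate_pos := pos_inr_mk_add (t.mate_lt j.2)
      have := unmatched_lt_mate_of_lt (t.mate_defect (b.rank i)) (y := j) (by omega)
      omega
  · rw [halvesMate_of_ne h hi] at hj
    have := b.mate_lt i.2
    change _ < b.mate i at hj
    omega

theorem halvesMate_nested_inr_inr {i j : Fin n} (hij : pos (.inr i) < pos (.inr j))
    (hj : pos (.inr j) < pos (halvesMate b t h (.inr i))) :
    pos (halvesMate b t h (.inr j)) < pos (halvesMate b t h (.inr i)) := by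
  have hi_pos := pos_inr_add i
  have hj_pos := pos_inr_add j
  by_cases hi : t.mate i = i
  · rw [halvesMate_inr_of_eq h hi] at hj
    have := defect_rank_lt h.symm hi
    change _ < b.defect _ at hj
    omega
  · rw [halvesMate_inr_of_ne h hi] at hj ⊢
    have hmate_pos := pos_inr_mk_add (t.mate_lt i.2)
    have hnested := t.nested (t.mate i) j (by omega) (by rw [t.mate_mate]; omega)
    rw [halvesMate_inr_of_ne h hnested.2.2]
    have hmate_pos' := pos_inr_mk_add (t.mate_lt j.2)
    omega

variable (b t) in
/-- The diagram with bottom half `b` and top half `t`. -/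
noncomputable def ofHalves : Diagram n :=
  ofMate (halvesMate b t h) (halvesMate_ne h) (halvesMate_halvesMate h) fun p q hpq hq => by
    rcases p with i | i <;> rcases q with j | j
    · exact halvesMate_nested_inl_inl h hpq hq
    · exact halvesMate_nested_inl_inr h hq
    · have := pos_inr_add i
      change _ < (j : ℕ) at hpq
      omega
    · exact halvesMate_nested_inr_inr h hpq hq

theorem ofHalves_mate (p : Pt n) : (ofHalves b t h).mate p = halvesMate b t h p :=
  (eq_mate (d := ofHalves b t h) (halvesMate_ne h p) (Or.inr rfl)).symm

theorem flip_ofHalves : (ofHalves b t h).flip = ofHalves t b h.symm := by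
  refine eq_of_le fun p q hpq => ?_
  rw [rel_iff, flip_mate, ofHalves_mate, halvesMate_swap, Sum.swap_swap] at hpq
  exact hpq

theorem bottom_ofHalves : (ofHalves b t h).bottom = b := by
  ext x
  rcases lt_or_ge x n with hx | hx
  · have hmate := ofHalves_mate h (.inl ⟨x, hx⟩)
    by_cases hxb : b.mate x = x
    · rw [halvesMate_of_eq h hxb] at hmate
      exact (capMate_of_eq_inr hmate).trans hxb.symm
    · rw [halvesMate_of_ne h hxb] at hmate
      exact capMate_of_eq_inl hmate
  · rw [mate_of_le _ x hx, mate_of_le _ x hx]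

theorem top_ofHalves : (ofHalves b t h).top = t := by
  rw [← bottom_flip, flip_ofHalves, bottom_ofHalves]

end OfHalves

variable {a b : Diagram n}

theorem bottomHalf_eq_iff : a.bottomHalf = b.bottomHalf ↔ a.bottom = b.bottom := by
  rw [← rel_bottom, ← rel_bottom, rel_injective.eq_iff]

theorem topHalf_eq_iff : a.topHalf = b.topHalf ↔ a.top = b.top :=
  bottomHalf_eq_iff (a := a.flip) (b := b.flip)

theorem through_eq_defects_top (d : Diagram n) : d.through = d.top.defects :=
  d.through_eq_defects_bottom.trans d.defects_bottom_eq_defects_top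

theorem through_le (d : Diagram n) : d.through ≤ n :=
  d.through_eq_defects_bottom.trans_le d.bottom.defects_le

theorem through_modEq (d : Diagram n) : d.through ≡ n [MOD 2] :=
  d.through_eq_defects_bottom ▸ d.bottom.defects_modEq

theorem through_ofHalves {b t : HalfDiagram n} (h : b.defects = t.defects) :
    (ofHalves b t h).through = b.defects := by
  rw [through_eq_defects_bottom, bottom_ofHalves]

theorem through_le_of_bottomHalf_le (h : a.bottomHalf ≤ b.bottomHalf) : b.through ≤ a.through := by
  rw [through_eq_defects_bottom, through_eq_defects_bottom]
  exact defects_le_of_rel_le (by rwa [rel_bottom, rel_bottom])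

theorem through_le_of_topHalf_le (h : a.topHalf ≤ b.topHalf) : b.through ≤ a.through := by
  rw [through_eq_defects_top, through_eq_defects_top]
  exact defects_le_of_rel_le (by rwa [rel_top, rel_top])

theorem bottomHalf_eq_of_le (h : a.bottomHalf ≤ b.bottomHalf) (hthrough : a.through ≤ b.through) :
    a.bottomHalf = b.bottomHalf := by
  rw [through_eq_defects_bottom, through_eq_defects_bottom] at hthrough
  exact bottomHalf_eq_iff.2 (eq_of_rel_le (by rwa [rel_bottom, rel_bottom]) hthrough)

theorem topHalf_eq_of_le (h : a.topHalf ≤ b.topHalf) (hthrough : a.through ≤ b.through) :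
    a.topHalf = b.topHalf := by
  rw [through_eq_defects_top, through_eq_defects_top] at hthrough
  exact topHalf_eq_iff.2 (eq_of_rel_le (by rwa [rel_top, rel_top]) hthrough)

theorem comp_flip_comp_of_topHalf_le (h : a.topHalf ≤ b.topHalf) :
    (a.comp a.flip).comp b = b := by
  refine flip_injective ?_
  rw [flip_comp, flip_comp]
  exact comp_flip_comp (a := a.flip) (b := b.flip) h

theorem bottomHalf_flip_comp_self (d : Diagram n) :
    (d.flip.comp d).bottomHalf = d.bottomHalf := by
  refine le_antisymm ?_ (bottomHalf_le_comp _ _)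
  calc (d.flip.comp d).bottomHalf
    _ ≤ (d.comp (d.flip.comp d)).bottomHalf := bottomHalf_le_comp _ _
    _ = d.bottomHalf := by rw [comp_flip_comp le_rfl]

theorem exists_through_eq {k : ℕ} (hk : k ≤ n) (hmod : k ≡ n [MOD 2]) :
    ∃ d : Diagram n, d.through = k := by
  obtain ⟨b, -, hb⟩ := exists_rel_le_defects_eq (HalfDiagram.id n) (l := k)
    (by rwa [defects_id]) (by rwa [defects_id])
  exact ⟨ofHalves b b rfl, (through_ofHalves rfl).trans hb⟩

theorem exists_bottomHalf_le_topHalf_eq (h : b.through ≤ a.through) :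
    ∃ c : Diagram n, a.bottomHalf ≤ c.bottomHalf ∧ c.topHalf = b.topHalf := by
  obtain ⟨c, hc, hdef⟩ := exists_rel_le_defects_eq a.bottom (l := b.through)
    (h.trans_eq a.through_eq_defects_bottom)
    (b.through_modEq.trans a.bottom.defects_modEq.symm)
  have hcb : c.defects = b.top.defects := hdef.trans b.through_eq_defects_top
  refine ⟨ofHalves c b.top hcb, ?_, topHalf_eq_iff.2 (top_ofHalves hcb)⟩
  rwa [← rel_bottom, ← rel_bottom, bottom_ofHalves]

theorem ncard_bottom_eq (b : HalfDiagram n) :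
    {d : Diagram n | d.bottom = b}.ncard = halfCount n b.defects := by
  refine Set.BijOn.ncard_eq (f := top) ⟨?_, fun d hd d' hd' => eq_of_halves (hd.trans hd'.symm), ?_⟩
  · rintro d rfl
    exact d.defects_bottom_eq_defects_top.symm
  · intro t ht
    exact ⟨ofHalves b t (Eq.symm ht), bottom_ofHalves _, top_ofHalves _⟩

theorem ncard_top_eq (t : HalfDiagram n) :
    {d : Diagram n | d.top = t}.ncard = halfCount n t.defects := by
  rw [← ncard_bottom_eq]
  refine Set.BijOn.ncard_eq (f := flip) ⟨fun d hd => hd, flip_injective.injOn, fun d hd => ?_⟩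
  exact ⟨d.flip, d.top_flip.trans hd, d.flip_flip⟩

theorem ncard_through_eq (k : ℕ) :
    {d : Diagram n | d.through = k}.ncard = halfCount n k * halfCount n k := by
  rw [halfCount, ← Set.ncard_prod]
  refine Set.BijOn.ncard_eq (f := fun d => (d.bottom, d.top)) ⟨?_, ?_, ?_⟩
  · rintro d rfl
    exact ⟨d.through_eq_defects_bottom.symm, d.through_eq_defects_top.symm⟩
  · exact fun d _ d' _ h => eq_of_halves (congrArg Prod.fst h) (congrArg Prod.snd h)
  · rintro ⟨b, t⟩ ⟨rfl, ht⟩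
    exact ⟨ofHalves b t (Eq.symm ht), through_ofHalves _,
      Prod.ext (bottom_ofHalves _) (top_ofHalves _)⟩

end Diagram

open Diagram

section Orders

variable {x y : CyclicTL m n}

theorem internal_mul (x y : CyclicTL m n) :
    (x * y).internal = x.internal + y.internal + (Phi x.skeleton y.skeleton : ZMod m) := rfl

theorem leftLE_iff : LeftLE x y ↔ x.skeleton.bottomHalf ≤ y.skeleton.bottomHalf := by
  constructor
  · rintro ⟨c, rfl⟩
    exact bottomHalf_le_comp _ _
  · intro h
    let c := y.skeleton.comp x.skeleton.flip
    refine ⟨⟨c, y.internal - x.internal - (Phi c x.skeleton : ZMod m)⟩, CyclicTL.ext ?_ ?_⟩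
    · exact ((glue_three _ _ _).1.trans (comp_flip_comp h)).symm
    · rw [internal_mul]
      ring

theorem rightLE_iff : RightLE x y ↔ x.skeleton.topHalf ≤ y.skeleton.topHalf := by
  constructor
  · rintro ⟨c, rfl⟩
    exact topHalf_le_comp _ _
  · intro h
    let c := x.skeleton.flip.comp y.skeleton
    refine ⟨⟨c, y.internal - x.internal - (Phi x.skeleton c : ZMod m)⟩, CyclicTL.ext ?_ ?_⟩
    · exact ((glue_three _ _ _).1.symm.trans (comp_flip_comp_of_topHalf_le h)).symm
    · rw [internal_mul]
      ring

theorem leftEquiv_iff : LeftEquiv x y ↔ x.skeleton.bottomHalf = y.skeleton.bottomHalf := by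
  rw [LeftEquiv, leftLE_iff, leftLE_iff, le_antisymm_iff]

theorem rightEquiv_iff : RightEquiv x y ↔ x.skeleton.topHalf = y.skeleton.topHalf := by
  rw [RightEquiv, rightLE_iff, rightLE_iff, le_antisymm_iff]

theorem through_le_of_leftLE (h : LeftLE x y) : y.skeleton.through ≤ x.skeleton.through :=
  through_le_of_bottomHalf_le (leftLE_iff.1 h)

theorem through_le_of_rightLE (h : RightLE x y) : y.skeleton.through ≤ x.skeleton.through :=
  through_le_of_topHalf_le (rightLE_iff.1 h)

theorem through_lt_of_leftLE (h : LeftLE x y) (h' : ¬ LeftLE y x) :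
    y.skeleton.through < x.skeleton.through :=
  not_le.1 fun hthrough =>
    h' (leftLE_iff.2 (bottomHalf_eq_of_le (leftLE_iff.1 h) hthrough).ge)

theorem through_lt_of_rightLE (h : RightLE x y) (h' : ¬ RightLE y x) :
    y.skeleton.through < x.skeleton.through :=
  not_le.1 fun hthrough =>
    h' (rightLE_iff.2 (topHalf_eq_of_le (rightLE_iff.1 h) hthrough).ge)

theorem twoSidedLE_iff : TwoSidedLE x y ↔ y.skeleton.through ≤ x.skeleton.through := by
  constructor
  · rintro ⟨c, d, rfl⟩
    exact (through_le_of_rightLE ⟨d, rfl⟩).trans (through_le_of_leftLE ⟨c, rfl⟩)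
  · intro h
    obtain ⟨z, hxz, hzy⟩ := exists_bottomHalf_le_topHalf_eq h
    obtain ⟨c, hc⟩ : LeftLE x ⟨z, 0⟩ := leftLE_iff.2 hxz
    obtain ⟨d, hd⟩ : RightLE ⟨z, 0⟩ y := rightLE_iff.2 hzy.le
    exact ⟨c, d, hc ▸ hd⟩

theorem twoSidedEquiv_iff : TwoSidedEquiv x y ↔ y.skeleton.through = x.skeleton.through := by
  rw [TwoSidedEquiv, twoSidedLE_iff, twoSidedLE_iff, le_antisymm_iff]

theorem setOf_twoSidedEquiv (x : CyclicTL m n) :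
    {y | TwoSidedEquiv x y} = throughClass m n x.skeleton.through :=
  Set.ext fun _ => twoSidedEquiv_iff

theorem isJCell_iff (J : Set (CyclicTL m n)) :
    IsJCell J ↔ ∃ k, k ≤ n ∧ k ≡ n [MOD 2] ∧ J = throughClass m n k := by
  constructor
  · rintro ⟨x, rfl⟩
    exact ⟨_, x.skeleton.through_le, x.skeleton.through_modEq, setOf_twoSidedEquiv x⟩
  · rintro ⟨k, hk, hmod, rfl⟩
    obtain ⟨d, rfl⟩ := exists_through_eq hk hmod
    exact ⟨⟨d, 0⟩, (setOf_twoSidedEquiv ⟨d, 0⟩).symm⟩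

theorem jCellLE_iff {J K : {J : Set (CyclicTL m n) // IsJCell J}} {x y : CyclicTL m n}
    (hx : J.1 = {z | TwoSidedEquiv x z}) (hy : K.1 = {z | TwoSidedEquiv y z}) :
    JCellLE J K ↔ y.skeleton.through ≤ x.skeleton.through := by
  rw [JCellLE, hx, hy]
  refine ⟨fun h => twoSidedLE_iff.1 (h x (twoSidedEquiv_iff.2 rfl) y (twoSidedEquiv_iff.2 rfl)),
    fun h a ha b hb => twoSidedLE_iff.2 ?_⟩
  rwa [twoSidedEquiv_iff.1 ha, twoSidedEquiv_iff.1 hb]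

theorem isLinearOrder_jCellLE :
    IsLinearOrder {J : Set (CyclicTL m n) // IsJCell J} JCellLE where
  refl := by
    rintro ⟨_, x, rfl⟩
    exact (jCellLE_iff rfl rfl).2 le_rfl
  trans := by
    rintro ⟨_, x, rfl⟩ ⟨_, y, rfl⟩ ⟨_, z, rfl⟩ hxy hyz
    exact (jCellLE_iff rfl rfl).2
      (((jCellLE_iff rfl rfl).1 hyz).trans ((jCellLE_iff rfl rfl).1 hxy))
  antisymm := by
    rintro ⟨_, x, rfl⟩ ⟨_, y, rfl⟩ hxy hyx
    have hthrough := ((jCellLE_iff rfl rfl).1 hyx).antisymm ((jCellLE_iff rfl rfl).1 hxy)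
    refine Subtype.ext ((setOf_twoSidedEquiv x).trans ?_)
    rw [hthrough]
    exact (setOf_twoSidedEquiv y).symm
  total := by
    rintro ⟨_, x, rfl⟩ ⟨_, y, rfl⟩
    rw [jCellLE_iff rfl rfl, jCellLE_iff rfl rfl]
    exact le_total _ _

end Orders

section Cells

theorem leftEquiv_and_rightEquiv_iff {x y : CyclicTL m n} :
    LeftEquiv x y ∧ RightEquiv x y ↔ y.skeleton = x.skeleton := by
  rw [leftEquiv_iff, rightEquiv_iff, bottomHalf_eq_iff, topHalf_eq_iff]
  exact ⟨fun h => (eq_of_halves h.1 h.2).symm, fun h => ⟨by rw [h], by rw [h]⟩⟩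

theorem isHCell_iff (H : Set (CyclicTL m n)) :
    IsHCell H ↔ ∃ d : Diagram n, H = {x | x.skeleton = d} := by
  constructor
  · rintro ⟨⟨z, hz⟩, _, _, ⟨x, rfl⟩, ⟨y, rfl⟩, rfl⟩
    have hbottom := leftEquiv_iff.1 hz.1
    have htop := rightEquiv_iff.1 hz.2
    refine ⟨z.skeleton, Set.ext fun w => Iff.trans ?_ leftEquiv_and_rightEquiv_iff⟩
    change LeftEquiv x w ∧ RightEquiv y w ↔ LeftEquiv z w ∧ RightEquiv z w
    rw [leftEquiv_iff, leftEquiv_iff, rightEquiv_iff, rightEquiv_iff, hbottom, htop]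
  · rintro ⟨d, rfl⟩
    exact ⟨⟨⟨d, 0⟩, rfl⟩, _, _, ⟨⟨d, 0⟩, rfl⟩, ⟨⟨d, 0⟩, rfl⟩,
      Set.ext fun w => (leftEquiv_and_rightEquiv_iff (x := ⟨d, 0⟩) (y := w)).symm⟩

theorem ncard_setOf_skeleton_mem (m : ℕ) (s : Set (Diagram n)) :
    {x : CyclicTL m n | x.skeleton ∈ s}.ncard = s.ncard * m := by
  let e : {x : CyclicTL m n | x.skeleton ∈ s} ≃ s × ZMod m :=
    { toFun := fun x => (⟨x.1.skeleton, x.2⟩, x.1.internal)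
      invFun := fun p => ⟨⟨p.1, p.2⟩, p.1.2⟩ }
  rw [← Nat.card_coe_set_eq, Nat.card_congr e, Nat.card_prod, Nat.card_zmod, Nat.card_coe_set_eq]

theorem ncard_isHCell {H : Set (CyclicTL m n)} (hH : IsHCell H) : H.ncard = m := by
  obtain ⟨d, rfl⟩ := (isHCell_iff H).1 hH
  exact (ncard_setOf_skeleton_mem m {d}).trans (by rw [Set.ncard_singleton, one_mul])

theorem ncard_throughClass (m n k : ℕ) :
    (throughClass m n k).ncard = halfCount n k * halfCount n k * m := by
  rw [← ncard_through_eq, ← ncard_setOf_skeleton_mem]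
  rfl

theorem ncard_isLeftCell {k : ℕ} {L : Set (CyclicTL m n)} (hL : IsLeftCell L)
    (hk : L ⊆ throughClass m n k) : L.ncard = halfCount n k * m := by
  obtain ⟨x, rfl⟩ := hL
  have hx : x.skeleton.through = k := hk (leftEquiv_iff.2 rfl)
  rw [← hx, through_eq_defects_bottom, ← ncard_bottom_eq, ← ncard_setOf_skeleton_mem]
  congr 1 with y
  exact leftEquiv_iff.trans (bottomHalf_eq_iff.trans eq_comm)

theorem ncard_isRightCell {k : ℕ} {R : Set (CyclicTL m n)} (hR : IsRightCell R)
    (hk : R ⊆ throughClass m n k) : R.ncard = halfCount n k * m := by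
  obtain ⟨x, rfl⟩ := hR
  have hx : x.skeleton.through = k := hk (rightEquiv_iff.2 rfl)
  rw [← hx, through_eq_defects_top, ← ncard_top_eq, ← ncard_setOf_skeleton_mem]
  congr 1 with y
  exact rightEquiv_iff.trans (topHalf_eq_iff.trans eq_comm)

theorem cast_halfCount_mul_eq (m : ℕ) {k : ℕ} (hk : k ≤ n) (hmod : k ≡ n [MOD 2]) :
    ((halfCount n k * m : ℕ) : ℚ) = m * ((k + 1) / (n - capNumber n k + 1)) *
      n.choose (capNumber n k) := by
  rw [Nat.cast_mul, halfCount_eq hk hmod]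
  ring

theorem isIdempotentCell_of_isJCell {J : Set (CyclicTL m n)} (hJ : IsJCell J) :
    IsIdempotentCell J := by
  obtain ⟨x, rfl⟩ := hJ
  let e := x.skeleton.flip.comp x.skeleton
  have he : e.comp e = e := comp_flip_comp (bottomHalf_le_comp _ _)
  refine ⟨⟨e, -(Phi e e : ZMod m)⟩, twoSidedEquiv_iff.2 ?_, CyclicTL.ext he ?_⟩
  · exact (through_le_of_bottomHalf_le (bottomHalf_flip_comp_self _).ge).antisymm
      (through_le_of_bottomHalf_le (bottomHalf_flip_comp_self _).le)
  · rw [internal_mul]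
    ring

theorem exists_mulHom_of_isIdempotentCell {H : Set (CyclicTL m n)} (hH : IsHCell H)
    (hidem : IsIdempotentCell H) : ∃ f : Multiplicative (ZMod m) →ₙ* CyclicTL m n,
      Function.Injective f ∧ Set.range f = H := by
  obtain ⟨d, rfl⟩ := (isHCell_iff H).1 hH
  obtain ⟨e, rfl, he⟩ := hidem
  have hskeleton : e.skeleton.comp e.skeleton = e.skeleton := congrArg CyclicTL.skeleton he
  let φ : ZMod m := (Phi e.skeleton e.skeleton : ℕ)
  refine ⟨⟨fun i => ⟨e.skeleton, i.toAdd - φ⟩, fun i j => CyclicTL.ext hskeleton.symm ?_⟩, ?_, ?_⟩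
  · rw [internal_mul, toAdd_mul]
    change _ = i.toAdd - φ + (j.toAdd - φ) + φ
    ring
  · intro i j hij
    exact Multiplicative.toAdd.injective (sub_left_injective (congrArg CyclicTL.internal hij))
  · refine Set.Subset.antisymm (Set.range_subset_iff.2 fun i => rfl) fun x hx => ?_
    exact ⟨.ofAdd (x.internal + φ), CyclicTL.ext (Eq.symm hx) (add_sub_cancel_right _ φ)⟩

end Cells

end TemperleyLieb

theorem propositionP (m n : ℕ) (hm : 1 ≤ m) :
    open TemperleyLieb in
    -- the cell structure is that of the Temperley--Lieb monoid, with `H`-cells of size `m`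
    ((∀ x y : CyclicTL m n, LeftLE x y ↔ LeftLE x.toTL y.toTL) ∧
      (∀ x y : CyclicTL m n, RightLE x y ↔ RightLE x.toTL y.toTL) ∧
      (∀ x y : CyclicTL m n, TwoSidedLE x y ↔ TwoSidedLE x.toTL y.toTL) ∧
      (∀ H : Set (CyclicTL m n), IsHCell H ↔ ∃ d : Diagram n, H = {x | x.skeleton = d}) ∧
      (∀ H : Set (CyclicTL m n), IsHCell H → H.ncard = m)) ∧
    -- left and right cells
    ((∀ x y : CyclicTL m n,
        LeftEquiv x y ↔ x.skeleton.bottomHalf = y.skeleton.bottomHalf) ∧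
      (∀ x y : CyclicTL m n,
        RightEquiv x y ↔ x.skeleton.topHalf = y.skeleton.topHalf)) ∧
    -- `J`-cells
    (∀ J : Set (CyclicTL m n),
      IsJCell J ↔ ∃ k, k ≤ n ∧ k ≡ n [MOD 2] ∧ J = throughClass m n k) ∧
    -- the orders
    ((∀ x y : CyclicTL m n, LeftLE x y → y.skeleton.through ≤ x.skeleton.through) ∧
      (∀ x y : CyclicTL m n, LeftLE x y → ¬ LeftLE y x →
        y.skeleton.through < x.skeleton.through) ∧
      (∀ x y : CyclicTL m n, RightLE x y → y.skeleton.through ≤ x.skeleton.through) ∧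
      (∀ x y : CyclicTL m n, RightLE x y → ¬ RightLE y x →
        y.skeleton.through < x.skeleton.through) ∧
      (∀ x y : CyclicTL m n,
        TwoSidedLE x y ↔ y.skeleton.through ≤ x.skeleton.through) ∧
      IsLinearOrder {J : Set (CyclicTL m n) // IsJCell J} JCellLE) ∧
    -- sizes of left and right cells
    (∀ k, k ≤ n → k ≡ n [MOD 2] →
      (∀ L : Set (CyclicTL m n), IsLeftCell L → L ⊆ throughClass m n k →
        (L.ncard : ℚ) = (m : ℚ) * (((k : ℚ) + 1) / ((n : ℚ) - (capNumber n k : ℚ) + 1)) *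
          (n.choose (capNumber n k) : ℚ)) ∧
      (∀ R : Set (CyclicTL m n), IsRightCell R → R ⊆ throughClass m n k →
        (R.ncard : ℚ) = (m : ℚ) * (((k : ℚ) + 1) / ((n : ℚ) - (capNumber n k : ℚ) + 1)) *
          (n.choose (capNumber n k) : ℚ))) ∧
    -- sizes of `J`-cells
    (∀ k, k ≤ n → k ≡ n [MOD 2] →
      ∀ L : Set (CyclicTL m n), IsLeftCell L → L ⊆ throughClass m n k →
        ((throughClass m n k).ncard : ℚ) = (L.ncard : ℚ) ^ 2 / (m : ℚ)) ∧
    -- regularity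
    (∀ J : Set (CyclicTL m n), IsJCell J → IsIdempotentCell J) ∧
    -- idempotent `H`-cells are cyclic groups of order `m` under the multiplication of the monoid
    (∀ H : Set (CyclicTL m n), IsHCell H → IsIdempotentCell H →
      ∃ f : Multiplicative (ZMod m) →ₙ* CyclicTL m n,
        Function.Injective f ∧ Set.range f = H) := by
  open TemperleyLieb in
  refine ⟨⟨fun x y => ?_, fun x y => ?_, fun x y => ?_, isHCell_iff, fun _ => ncard_isHCell⟩,
    ⟨fun _ _ => leftEquiv_iff, fun _ _ => rightEquiv_iff⟩, isJCell_iff,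
    ⟨fun _ _ => through_le_of_leftLE, fun _ _ => through_lt_of_leftLE,
      fun _ _ => through_le_of_rightLE, fun _ _ => through_lt_of_rightLE,
      fun _ _ => twoSidedLE_iff, isLinearOrder_jCellLE⟩,
    fun k hk hmod => ⟨fun L hL hLk => ?_, fun R hR hRk => ?_⟩, fun k _ _ L hL hLk => ?_,
    fun _ => isIdempotentCell_of_isJCell, fun _ => exists_mulHom_of_isIdempotentCell⟩
  · exact leftLE_iff.trans (leftLE_iff (x := x.toTL) (y := y.toTL)).symm
  · exact rightLE_iff.trans (rightLE_iff (x := x.toTL) (y := y.toTL)).symm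
  · exact twoSidedLE_iff.trans (twoSidedLE_iff (x := x.toTL) (y := y.toTL)).symm
  · rw [ncard_isLeftCell hL hLk, cast_halfCount_mul_eq m hk hmod]
  · rw [ncard_isRightCell hR hRk, cast_halfCount_mul_eq m hk hmod]
  · have hm₀ : (m : ℚ) ≠ 0 := by positivity
    rw [ncard_isLeftCell hL hLk, ncard_throughClass, eq_div_iff hm₀]
    push_cast
    ring
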